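/- **Definitions.** An arithmetic matroid $\mathcal A=(E,\operatorname{rk},m)$ is a matroid on a finite set $E$ with a multiplicity function $m:2^E\to\mathbb Z_{\ge 1}$ satisfying the axioms (P), (A1), (A2) of D'Adderio–Moci and Brändén–Moci. It is *represented* by a list $X=(x_e)_{e\in E}$ in a finitely generated abelian group $G$ with torsion subgroup $G_t$ if the image of $X$ in $G/G_t$ represents the matroid $(E,\operatorname{rk})$ and $m(A)=|G_A/\langle A\rangle|$ for all $A\subseteq E$, where $\langle A\rangle$ is the subgroup generated by $\{x_e : e\in A\}$ and $G_A$ is the largest subgroup of $G$ containing $\langle A\rangle$ with finite index. It is *torsion-free* if $m(\emptyset)=1$. A *lifting* of $\mathcal A$ is an arithmetic matroid $\mathcal A'=(E\sqcup Y,\operatorname{rk}',m')$, $Y$ finite, with $\mathcal A'/Y=\mathcal A$, i.e. $\operatorname{rk}(B)=\operatorname{rk}'(B\cup Y)-\operatorname{rk}'(Y)$ and $m(B)=m'(B\cup Y)$ for $B\subseteq E$. A matroid is *regular* if it is represented by a totally unimodular matrix. A torsion-free arithmetic matroid is *regular* if it is representable and its underlying matroid is regular; an arithmetic matroid with torsion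 is *regular* if it has a lifting that is torsion-free and regular. A basis $B$ is *multiplicative* if $m(B)=\prod_{x\in B}m(\{x\})$. A *scaled unimodular list* is the list of columns of a matrix $AD$ with $A$ a totally unimodular integer matrix and $D$ a non-singular integer diagonal matrix. A list $X=(x_e)_{e\in E}$ in an abelian group is a *quotient of a scaled unimodular list* (QSUL) if there are integers $d,n\ge 0$ and a scaled unimodular list in $\mathbb Z^{d+n}$, indexed by $E\sqcup Y$ with $|Y|=n$, such that, up to isomorphism of the ambient group, $X$ is the image of the sublist indexed by $E$ in $\mathbb Z^{d+n}/\langle Y\rangle$. **Proposition.** Let $\mathcal A$ be a regular arithmetic matroid. Then the following are equivalent: (i) $\mathcal A$ is strongly multiplicative. If $\mathcal A$ is torsion-free, this means that all bases of $\mathcal A$ are multiplicative. If $\mathcal A$ has torsion, this means that $\mathcal A$ has a torsion-free lifting that is regular and all of whose bases are multiplicative (one and the same lifting having both properties). (ii) $\mathcal A$ can be represented by a quotient of a scaled unimodular list. -/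

import Mathlib

/-! ### Arithmetic matroids -/

/-- `R ⊆ R ∪ F ∪ T` is a molecule of the matroid `M`, with free part `F` and torsion part `T`. -/
structure IsMolecule {E : Type*} [DecidableEq E] (M : Matroid E) (R F T : Finset E) : Prop where
  disjoint_RF : Disjoint R F
  disjoint_RT : Disjoint R T
  disjoint_FT : Disjoint F T
  rank_eq : ∀ A : Finset E, R ⊆ A → A ⊆ R ∪ F ∪ T →
    M.eRk (A : Set E) = M.eRk (R : Set E) + ((A ∩ F).card : ℕ∞)

/-- An arithmetic matroid whose ground set is the (finite) type `E`: a matroid on all of `E`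
together with a multiplicity function satisfying the axioms (P), (A1), (A2). -/
structure ArithmeticMatroid (E : Type*) [Fintype E] [DecidableEq E] where
  /-- the underlying matroid -/
  matroid : Matroid E
  ground_eq : matroid.E = Set.univ
  /-- the multiplicity function -/
  m : Finset E → ℕ
  m_pos : ∀ A, 1 ≤ m A
  /-- axiom (P) -/
  axiom_P : ∀ R F T : Finset E, IsMolecule matroid R F T →
    0 ≤ (-1 : ℤ) ^ T.card *
      ∑ A ∈ Finset.Icc R (R ∪ F ∪ T), (-1 : ℤ) ^ ((R ∪ F ∪ T).card - A.card) * (m A : ℤ)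
  /-- axiom (A1), when adding `e` does not increase the rank -/
  axiom_A1_dep : ∀ (A : Finset E) (e : E),
    matroid.eRk (insert e A : Finset E) = matroid.eRk (A : Set E) → m (insert e A) ∣ m A
  /-- axiom (A1), when adding `e` increases the rank -/
  axiom_A1_indep : ∀ (A : Finset E) (e : E),
    matroid.eRk (insert e A : Finset E) ≠ matroid.eRk (A : Set E) → m A ∣ m (insert e A)
  /-- axiom (A2) -/
  axiom_A2 : ∀ R F T : Finset E, IsMolecule matroid R F T →
    m R * m (R ∪ F ∪ T) = m (R ∪ F) * m (R ∪ T)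

/-! ### Representations in finitely generated abelian groups -/

/-- The saturation of a subgroup `H`: all elements having a non-zero multiple in `H`. -/
def saturation {G : Type*} [AddCommGroup G] (H : AddSubgroup G) : AddSubgroup G where
  carrier := {g | ∃ k : ℕ, k ≠ 0 ∧ k • g ∈ H}
  zero_mem' := ⟨1, one_ne_zero, by simp⟩
  add_mem' := by
    rintro a b ⟨k, hk, ha⟩ ⟨l, hl, hb⟩
    refine ⟨k * l, mul_ne_zero hk hl, ?_⟩
    rw [smul_add]
    refine H.add_mem ?_ ?_
    · rw [mul_comm, mul_smul]
      exact H.nsmul_mem ha l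
    · rw [mul_smul]
      exact H.nsmul_mem hb k
  neg_mem' := by
    rintro a ⟨k, hk, ha⟩
    exact ⟨k, hk, by rw [smul_neg]; exact H.neg_mem ha⟩

/-- In a finitely generated abelian group, `saturation H` is the largest subgroup that
contains `H` with finite index. -/
theorem saturation_isGreatest {G : Type*} [AddCommGroup G] [AddGroup.FG G] (H : AddSubgroup G) :
    IsGreatest {K : AddSubgroup G | H ≤ K ∧ Finite (K ⧸ H.addSubgroupOf K)} (saturation H) := by
  refine ⟨⟨fun g hg => ⟨1, one_ne_zero, by simpa using hg⟩, ?_⟩, ?_⟩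
  · have : Module.Finite ℤ G := Module.Finite.iff_addGroup_fg.mpr inferInstance
    have : Module.Finite ℤ (saturation H) :=
      inferInstanceAs (Module.Finite ℤ (AddSubgroup.toIntSubmodule (saturation H)))
    have : AddGroup.FG (saturation H) := Module.Finite.iff_addGroup_fg.mp inferInstance
    have : Module.Finite ℤ (saturation H ⧸ H.addSubgroupOf (saturation H)) :=
      Module.Finite.iff_addGroup_fg.mpr inferInstance
    refine Module.finite_of_fg_torsion _ ?_
    rintro ⟨⟨g, k, hk, hg⟩⟩
    refine ⟨⟨(k : ℤ), mem_nonZeroDivisors_of_ne_zero (by exact_mod_cast hk)⟩, ?_⟩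
    refine (QuotientAddGroup.eq_zero_iff ((k : ℤ) • (⟨g, k, hk, hg⟩ : saturation H))).mpr ?_
    simpa [AddSubgroup.mem_addSubgroupOf] using hg
  · rintro K ⟨-, hfin⟩ g hg
    refine ⟨Nat.card (K ⧸ H.addSubgroupOf K), Nat.card_pos.ne', ?_⟩
    have h := card_nsmul_eq_zero' (x := ((⟨g, hg⟩ : K) : K ⧸ H.addSubgroupOf K))
    have h2 := (QuotientAddGroup.eq_zero_iff
      (Nat.card (K ⧸ H.addSubgroupOf K) • (⟨g, hg⟩ : K))).mp h
    simpa [AddSubgroup.mem_addSubgroupOf] using h2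

/-- The multiplicity `|G_A / ⟨A⟩|` of the subset `A` of a list `X` of elements of `G`, where `G_A`
is the largest subgroup of `G` that contains `⟨A⟩` with finite index. -/
noncomputable def listMultiplicity {E G : Type*} [AddCommGroup G] (X : E → G) (A : Finset E) : ℕ :=
  (AddSubgroup.closure (X '' (A : Set E))).relIndex
    (saturation (AddSubgroup.closure (X '' (A : Set E))))

/-- A matroid on `E` is regular if it is represented (over `ℚ`) by the columns of a totally
unimodular matrix. -/
def Matroid.IsRegular {E : Type*} (M : Matroid E) : Prop :=
  ∃ (r : ℕ) (B : Matrix (Fin r) E ℚ), B.IsTotallyUnimodular ∧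
    ∀ I : Set E, M.Indep I ↔ LinearIndepOn ℚ (fun e => B.col e) I

/-! ### Quotients of scaled unimodular lists -/

/-- The columns of `L` form a scaled unimodular list: `L = A D` with `A` totally unimodular and
`D` a non-singular integer diagonal matrix. -/
def IsScaledUnimodular {d : ℕ} {E : Type*} [Fintype E] [DecidableEq E]
    (L : Matrix (Fin d) E ℤ) : Prop :=
  ∃ (A : Matrix (Fin d) E ℤ) (δ : E → ℤ),
    A.IsTotallyUnimodular ∧ (∀ e, δ e ≠ 0) ∧ L = A * Matrix.diagonal δ

/-- The subgroup generated by the columns of `L` that are indexed by the right summand. -/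
def rightSpan {r n : ℕ} {E : Type*} (L : Matrix (Fin r) (E ⊕ Fin n) ℤ) : AddSubgroup (Fin r → ℤ) :=
  AddSubgroup.closure (Set.range fun i : Fin n => L.col (Sum.inr i))

/-- The list `X` of elements of the abelian group `G` is a quotient of a scaled unimodular list:
there are a scaled unimodular list `L` in `ℤ^(d+n)`, with a sublist `Y` of `n` columns, and an
identification of `ℤ^(d+n) / ⟨Y⟩` with `G` under which `X` is the image of the columns of `L`
that do not belong to `Y`. -/
def IsQSUL {E G : Type*} [Fintype E] [DecidableEq E] [AddCommGroup G] (X : E → G) : Prop :=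
  ∃ (d n : ℕ) (L : Matrix (Fin (d + n)) (E ⊕ Fin n) ℤ)
    (φ : ((Fin (d + n) → ℤ) ⧸ rightSpan L) ≃+ G),
    IsScaledUnimodular L ∧ ∀ e : E, X e = φ (QuotientAddGroup.mk (L.col (Sum.inl e)))

namespace ArithmeticMatroid

variable {E : Type*} [Fintype E] [DecidableEq E]

/-- The list `X` of elements of the abelian group `G` represents `𝒜`: its image in the quotient of
`G` by the torsion subgroup represents the underlying matroid, and its multiplicity function is
that of `𝒜`. -/
def IsRepresentedBy {G : Type*} [AddCommGroup G] (𝒜 : ArithmeticMatroid E) (X : E → G) : Prop :=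
  (∀ I : Set E, 𝒜.matroid.Indep I ↔
    LinearIndepOn ℤ (fun e => (QuotientAddGroup.mk (X e) : G ⧸ AddCommGroup.torsion G)) I) ∧
  ∀ A : Finset E, 𝒜.m A = listMultiplicity X A

/-- `𝒜` has a representation in a finitely generated abelian group. -/
def IsRepresentable (𝒜 : ArithmeticMatroid E) : Prop :=
  ∃ (G : Type) (_ : AddCommGroup G) (_ : AddGroup.FG G) (X : E → G), 𝒜.IsRepresentedBy X

/-- `𝒜` is represented by a quotient of a scaled unimodular list. -/
def IsRepresentedByQSUL (𝒜 : ArithmeticMatroid E) : Prop :=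
  ∃ (G : Type) (_ : AddCommGroup G) (_ : AddGroup.FG G) (X : E → G),
    IsQSUL X ∧ 𝒜.IsRepresentedBy X

/-- `𝒜` is torsion-free: the empty set has multiplicity one. -/
def IsTorsionFree (𝒜 : ArithmeticMatroid E) : Prop := 𝒜.m ∅ = 1

/-- The arithmetic matroid `ℬ` on `E ⊔ Y` is a lifting of `𝒜`, that is, `ℬ / Y = 𝒜`. -/
def IsLifting {n : ℕ} (ℬ : ArithmeticMatroid (E ⊕ Fin n)) (𝒜 : ArithmeticMatroid E) : Prop :=
  (ℬ.matroid.contract (Set.range Sum.inr)).comap Sum.inl = 𝒜.matroid ∧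
  ∀ A : Finset E, 𝒜.m A = ℬ.m (A.disjSum Finset.univ)

/-- All bases `B` are multiplicative: `m B` is the product of the `m {x}`, `x ∈ B`. -/
def AllBasesMultiplicative (𝒜 : ArithmeticMatroid E) : Prop :=
  ∀ B : Finset E, 𝒜.matroid.IsBase (B : Set E) → 𝒜.m B = ∏ x ∈ B, 𝒜.m {x}

/-- `𝒜` is torsion-free and regular: it is torsion-free, it is representable, and its underlying
matroid is regular. -/
def IsTorsionFreeRegular (𝒜 : ArithmeticMatroid E) : Prop :=
  𝒜.IsTorsionFree ∧ 𝒜.IsRepresentable ∧ 𝒜.matroid.IsRegular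

/-- `𝒜` is regular: it is torsion-free and regular or, if it has torsion, it has a lifting that
is torsion-free and regular. -/
def IsRegular (𝒜 : ArithmeticMatroid E) : Prop :=
  𝒜.IsTorsionFreeRegular ∨
  (¬ 𝒜.IsTorsionFree ∧ ∃ (n : ℕ) (ℬ : ArithmeticMatroid (E ⊕ Fin n)),
    ℬ.IsLifting 𝒜 ∧ ℬ.IsTorsionFreeRegular)

/-- The regular arithmetic matroid `𝒜` is strongly multiplicative: if it is torsion-free, all its
bases are multiplicative; if it has torsion, it is a quotient of a torsion-free arithmetic matroid
all of whose bases are multiplicative. In the second case the convention for arithmetic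
matroids that are regular and strongly multiplicative is in force: one and the same torsion-free
lifting is both regular and has only multiplicative bases. -/
def IsStronglyMultiplicative (𝒜 : ArithmeticMatroid E) : Prop :=
  (𝒜.IsTorsionFree ∧ 𝒜.AllBasesMultiplicative) ∨
  (¬ 𝒜.IsTorsionFree ∧ ∃ (n : ℕ) (ℬ : ArithmeticMatroid (E ⊕ Fin n)),
    ℬ.IsLifting 𝒜 ∧ ℬ.IsTorsionFreeRegular ∧ ℬ.AllBasesMultiplicative)

end ArithmeticMatroid

/-! ### Saturations -/

section Saturation

variable {E G H : Type*} [AddCommGroup G] [AddCommGroup H]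

/-! Both directions compare a list `x_e = δ_e p_e` with its unscaled vectors `p_e`. Call `p`
unimodular if each of its subfamilies generates a saturated subgroup. Then a subset `A` of the
scaled list has multiplicity `[⟨p_A⟩ : ⟨x_A⟩]`, and adjoining an element that raises the rank
multiplies it by `|δ_e|` (`relIndex_closure_insert`).

From (ii) to (i): the columns of a totally unimodular matrix are unimodular
(`Matrix.IsTotallyUnimodular.isUnimodularFamily`), so the scaled list defines a torsion-free
arithmetic matroid (`ArithmeticMatroid.ofUnimodular`). In axiom (P) the free part contributes `∏
(|δ_f| - 1)` and the torsion part counts characters of a finite group. Quotienting by `⟨Y⟩` is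
contracting `Y`, so this matroid is a lifting with multiplicative bases. If the quotient is itself
torsion-free, then `m(Y) = 1`, and the same product formula relative to `Y` makes its bases
multiplicative.

From (i) to (ii): a torsion-free representation lives in `ℤ^r`; write `x_e = δ_e p_e` with `p_e`
primitive. For a basis `B`, `m(B)` is `∏ |δ_e|` times the index of `⟨p_B⟩` in its saturation, so
multiplicativity makes `⟨p_B⟩` saturated (`saturation_closure_of_multiplicative`). All bases then
generate one and the same lattice, and in coordinates of a fixed basis the `p_e` form a totally
unimodular matrix (`isTotallyUnimodular_of_bases`). With torsion, this is applied to the lifting and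
`Y` is contracted afterwards. -/

theorem mem_saturation {K : AddSubgroup G} {g : G} :
    g ∈ saturation K ↔ ∃ k : ℕ, k ≠ 0 ∧ k • g ∈ K := Iff.rfl

theorem mem_saturation_of_zsmul_mem {K : AddSubgroup G} {g : G} {k : ℤ} (hk : k ≠ 0)
    (h : k • g ∈ K) : g ∈ saturation K := by
  refine ⟨k.natAbs, by simpa using hk, ?_⟩
  rw [← natCast_zsmul]
  rcases Int.natAbs_eq k with h' | h'
  · rwa [← h']
  · rwa [h', neg_smul, neg_mem_iff] at h

theorem le_saturation (K : AddSubgroup G) : K ≤ saturation K :=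
  fun g hg => ⟨1, one_ne_zero, by simpa using hg⟩

theorem saturation_mono {K L : AddSubgroup G} (h : K ≤ L) : saturation K ≤ saturation L :=
  fun _ ⟨k, hk, hg⟩ => ⟨k, hk, h hg⟩

theorem saturation_saturation (K : AddSubgroup G) : saturation (saturation K) = saturation K := by
  refine le_antisymm ?_ (le_saturation _)
  rintro g ⟨k, hk, l, hl, hg⟩
  exact ⟨l * k, mul_ne_zero hl hk, by rwa [mul_smul]⟩

theorem saturation_le_saturation_iff {K L : AddSubgroup G} :
    saturation K ≤ saturation L ↔ K ≤ saturation L :=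
  ⟨(le_saturation K).trans, fun h => saturation_saturation L ▸ saturation_mono h⟩

theorem comap_saturation (f : G →+ H) (K : AddSubgroup H) :
    (saturation K).comap f = saturation (K.comap f) := by
  ext g
  simp [mem_saturation]

/-- Saturatedness of the range is what stops the saturation of an image from leaving the range. -/
theorem map_saturation_of_injective (f : G →+ H) (hf : Function.Injective f)
    (hr : saturation f.range = f.range) (K : AddSubgroup G) :
    saturation (K.map f) = (saturation K).map f := by
  ext h
  constructor
  · intro hh
    have : h ∈ f.range := hr ▸ saturation_mono (AddSubgroup.map_le_range f K) hh
    obtain ⟨g, rfl⟩ := this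
    refine ⟨g, ?_, rfl⟩
    have : g ∈ (saturation (K.map f)).comap f := hh
    rwa [comap_saturation, AddSubgroup.comap_map_eq_self_of_injective hf] at this
  · rintro ⟨g, ⟨k, hk, hg⟩, rfl⟩
    exact ⟨k, hk, k • g, hg, map_nsmul f k g⟩

theorem saturation_bot_of_isAddTorsionFree [IsAddTorsionFree G] :
    saturation (⊥ : AddSubgroup G) = ⊥ := by
  rw [eq_bot_iff]
  rintro g ⟨k, hk, hg⟩
  simpa [hk] using hg

theorem relIndex_saturation_ne_zero [AddGroup.FG G] (K : AddSubgroup G) :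
    K.relIndex (saturation K) ≠ 0 := by
  have := (saturation_isGreatest K).1.2
  exact (AddSubgroup.finiteIndex_of_finite_quotient (H := K.addSubgroupOf (saturation K))).index_ne_zero

theorem closure_image_insert (X : E → G) (A : Set E) (e : E) :
    AddSubgroup.closure (X '' insert e A) =
      AddSubgroup.closure (X '' A) ⊔ AddSubgroup.zmultiples (X e) := by
  rw [Set.image_insert_eq, Set.insert_eq, AddSubgroup.closure_union, sup_comm,
    AddSubgroup.zmultiples_eq_closure]

theorem mem_closure_image_insert {X : E → G} {A : Set E} {e : E} {g : G} :
    g ∈ AddSubgroup.closure (X '' insert e A) ↔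
      ∃ a ∈ AddSubgroup.closure (X '' A), ∃ c : ℤ, a + c • X e = g := by
  rw [closure_image_insert, AddSubgroup.mem_sup]
  simp [AddSubgroup.mem_zmultiples_iff]

/-- The exchange property of the closure operator attached to a list. -/
theorem mem_saturation_exchange {X : E → G} {A : Set E} {e f : E}
    (h : X e ∈ saturation (AddSubgroup.closure (X '' insert f A)))
    (h' : X e ∉ saturation (AddSubgroup.closure (X '' A))) :
    X f ∈ saturation (AddSubgroup.closure (X '' insert e A)) := by
  obtain ⟨k, hk, hg⟩ := h
  obtain ⟨a, ha, c, hc⟩ := mem_closure_image_insert.mp hg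
  have hc0 : c ≠ 0 := by
    rintro rfl
    exact h' ⟨k, hk, by simpa [← hc] using ha⟩
  refine mem_saturation_of_zsmul_mem hc0 (mem_closure_image_insert.mpr
    ⟨-a, neg_mem ha, k, ?_⟩)
  rw [natCast_zsmul, ← hc]
  abel

/-- Coefficients of a relation cannot be divided over `ℤ`: a relation involving `e` only puts a
nonzero multiple of `X e` in the span of the others, hence saturations instead of spans. -/
theorem linearIndepOn_int_iff (X : E → G) (I : Set E) :
    LinearIndepOn ℤ X I ↔
      ∀ e ∈ I, X e ∉ saturation (AddSubgroup.closure (X '' (I \ {e}))) := by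
  have key : ∀ (A : Set E) (g : G), g ∈ AddSubgroup.closure (X '' A) ↔
      ∃ l ∈ Finsupp.supported ℤ ℤ A, Finsupp.linearCombination ℤ X l = g := by
    intro A g
    rw [← Finsupp.mem_span_image_iff_linearCombination, ← Submodule.span_int_eq_addSubgroupClosure]
    rfl
  rw [linearIndepOn_iff]
  constructor
  · rintro h e he ⟨k, hk, hg⟩
    obtain ⟨l, hl, hlk⟩ := (key _ _).mp hg
    have h0 := h (l - Finsupp.single e (k : ℤ))
      (sub_mem (Finsupp.supported_mono Set.sdiff_subset hl) (Finsupp.single_mem_supported ℤ _ he))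
      (by simp [hlk])
    have hle : l e = 0 := by
      by_contra hne
      exact (hl (Finsupp.mem_support_iff.mpr hne)).2 rfl
    have := DFunLike.congr_fun h0 e
    simp [hle] at this
    exact hk this
  · intro h l hl hl0
    by_contra hne
    obtain ⟨e, he⟩ := Finsupp.ne_iff.mp hne
    refine h e (hl (Finsupp.mem_support_iff.mpr he)) (mem_saturation_of_zsmul_mem
      (k := l e) he ((key _ _).mpr ⟨-l.erase e, neg_mem ?_, ?_⟩))
    · intro i hi
      rw [Finset.mem_coe, Finsupp.mem_support_iff] at hi
      have hie : i ≠ e := by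
        rintro rfl
        exact hi Finsupp.erase_same
      exact ⟨hl (Finsupp.mem_support_iff.mpr (by rwa [Finsupp.erase_ne hie] at hi)), hie⟩
    · have := Finsupp.single_add_erase e l
      rw [← this, map_add, Finsupp.linearCombination_single] at hl0
      rw [map_neg, eq_comm]
      exact eq_neg_of_add_eq_zero_left hl0

theorem comap_mk_closure_image (N : AddSubgroup G) (X : E → G) (A : Set E) :
    (AddSubgroup.closure ((fun e => (QuotientAddGroup.mk (X e) : G ⧸ N)) '' A)).comap
      (QuotientAddGroup.mk' N) = AddSubgroup.closure (X '' A) ⊔ N := by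
  have : (fun e => (QuotientAddGroup.mk (X e) : G ⧸ N)) '' A = QuotientAddGroup.mk' N '' (X '' A) := by
    rw [Set.image_image]; rfl
  rw [this, ← AddMonoidHom.map_closure, AddSubgroup.comap_map_eq, QuotientAddGroup.ker_mk']

theorem mk_mem_saturation_iff (N : AddSubgroup G) (X : E → G) (A : Set E) (g : G) :
    (QuotientAddGroup.mk g : G ⧸ N) ∈
      saturation (AddSubgroup.closure ((fun e => (QuotientAddGroup.mk (X e) : G ⧸ N)) '' A)) ↔
    g ∈ saturation (AddSubgroup.closure (X '' A) ⊔ N) := by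
  rw [← comap_mk_closure_image, ← comap_saturation]; rfl

/-- A torsion element has the multiple `0`, which lies in `K`. This lets the matroid be read off in
`G` itself, without passing to the quotient by torsion. -/
theorem saturation_sup_torsion (K : AddSubgroup G) :
    saturation (K ⊔ AddCommGroup.torsion G) = saturation K := by
  refine le_antisymm (saturation_le_saturation_iff.mpr (sup_le (le_saturation K) ?_))
    (saturation_mono le_sup_left)
  intro g hg
  obtain ⟨k, hk, hg⟩ := isOfFinAddOrder_iff_nsmul_eq_zero.mp hg
  exact ⟨k, hk.ne', by rw [hg]; exact zero_mem K⟩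

theorem linearIndepOn_mk_torsion_iff (X : E → G) (I : Set E) :
    LinearIndepOn ℤ (fun e => (QuotientAddGroup.mk (X e) : G ⧸ AddCommGroup.torsion G)) I ↔
      ∀ e ∈ I, X e ∉ saturation (AddSubgroup.closure (X '' (I \ {e}))) := by
  simp only [linearIndepOn_int_iff, mk_mem_saturation_iff, saturation_sup_torsion]

end Saturation

/-! ### Matroids represented by lists -/

section RepresentsMatroid

variable {E G : Type*} [AddCommGroup G]

/-- The closure operator of the matroid `M` on the type `E` is that of the list `X`. -/
structure RepresentsMatroid (X : E → G) (M : Matroid E) : Prop where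
  ground_eq : M.E = Set.univ
  mem_closure_iff : ∀ (A : Set E) (e : E),
    e ∈ M.closure A ↔ X e ∈ saturation (AddSubgroup.closure (X '' A))

theorem RepresentsMatroid.indep_iff {X : E → G} {M : Matroid E} (h : RepresentsMatroid X M) (I : Set E) :
    M.Indep I ↔ ∀ e ∈ I, X e ∉ saturation (AddSubgroup.closure (X '' (I \ {e}))) := by
  rw [Matroid.indep_iff_forall_notMem_closure_sdiff (by simp [h.ground_eq])]
  simp only [h.mem_closure_iff]

theorem not_mem_saturation_insert_of_indep {X : E → G} {I : Set E} {e : E} (he : e ∉ I)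
    (hI : ∀ f ∈ I, X f ∉ saturation (AddSubgroup.closure (X '' (I \ {f}))))
    (h : X e ∉ saturation (AddSubgroup.closure (X '' I))) :
    ∀ f ∈ insert e I, X f ∉ saturation (AddSubgroup.closure (X '' (insert e I \ {f}))) := by
  rintro f (rfl | hf)
  · simpa [Set.insert_sdiff_of_mem, Set.sdiff_singleton_eq_self he] using h
  · have hef : e ≠ f := by rintro rfl; exact he hf
    rw [← Set.insert_sdiff_singleton_comm hef]
    intro hX
    refine h ?_
    have := mem_saturation_exchange hX (hI f hf)
    rwa [Set.insert_sdiff_singleton, Set.insert_eq_of_mem hf] at this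

/-- For independent sets the closures agree by the exchange property; a general set has the same
closure and the same saturation as any of its bases. -/
theorem represents_of_indep_iff {X : E → G} {M : Matroid E} (hE : M.E = Set.univ)
    (h : ∀ I, M.Indep I ↔ ∀ e ∈ I, X e ∉ saturation (AddSubgroup.closure (X '' (I \ {e})))) :
    RepresentsMatroid X M := by
  refine ⟨hE, fun A e => ?_⟩
  have hind : ∀ I, M.Indep I → ∀ e, e ∈ M.closure I ↔
      X e ∈ saturation (AddSubgroup.closure (X '' I)) := by
    intro I hI e
    by_cases heI : e ∈ I
    · exact iff_of_true (M.mem_closure_of_mem heI (by simp [hE]))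
        (le_saturation _ (AddSubgroup.subset_closure ⟨e, heI, rfl⟩))
    rw [← not_iff_not, hI.notMem_closure_iff (by simp [hE])]
    constructor
    · rintro ⟨h1, -⟩
      have := (h _).mp h1 e (Set.mem_insert _ _)
      simpa [Set.insert_sdiff_of_mem, Set.sdiff_singleton_eq_self heI] using this
    · exact fun h1 => ⟨(h _).mpr (not_mem_saturation_insert_of_indep heI ((h I).mp hI) h1), heI⟩
  obtain ⟨I, hI⟩ := M.exists_isBasis A (by simp [hE])
  rw [← hI.closure_eq_closure, hind I hI.indep]
  have : saturation (AddSubgroup.closure (X '' A)) = saturation (AddSubgroup.closure (X '' I)) := by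
    refine le_antisymm (saturation_le_saturation_iff.mpr ?_)
      (saturation_mono (AddSubgroup.closure_mono (Set.image_mono hI.subset)))
    rw [AddSubgroup.closure_le]
    rintro _ ⟨f, hf, rfl⟩
    exact (hind I hI.indep f).mp (hI.subset_closure hf)
  rw [this]

theorem RepresentsMatroid.eRk_insert_eq_iff [Finite E] {X : E → G} {M : Matroid E} (h : RepresentsMatroid X M)
    (A : Set E) (e : E) :
    M.eRk (insert e A) = M.eRk A ↔ X e ∈ saturation (AddSubgroup.closure (X '' A)) := by
  rw [← h.mem_closure_iff]
  constructor
  · intro hr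
    by_contra hcl
    rw [M.eRk_insert_eq_add_one ⟨by simp [h.ground_eq], hcl⟩] at hr
    -- Finiteness matters: `r + 1 ≠ r` fails for `⊤`.
    have : M.eRk A ≠ ⊤ := by
      refine ne_top_of_le_ne_top ?_ (M.eRk_le_encard A)
      exact Set.encard_ne_top_iff.mpr (Set.toFinite A)
    exact absurd hr ((ENat.lt_add_one_iff this).mpr le_rfl).ne'
  · intro hcl
    rw [← M.eRk_insert_closure_eq, Set.insert_eq_of_mem hcl, M.eRk_closure_eq]

theorem ArithmeticMatroid.isRepresentedBy_iff [Fintype E] [DecidableEq E]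
    {𝒜 : ArithmeticMatroid E} {X : E → G} :
    𝒜.IsRepresentedBy X ↔
      RepresentsMatroid X 𝒜.matroid ∧ ∀ A : Finset E, 𝒜.m A = listMultiplicity X A := by
  unfold ArithmeticMatroid.IsRepresentedBy
  simp only [linearIndepOn_mk_torsion_iff]
  exact and_congr_left fun _ => ⟨represents_of_indep_iff 𝒜.ground_eq, RepresentsMatroid.indep_iff⟩

end RepresentsMatroid

/-! ### Matroids of integer matrices -/

section MatrixMatroid

variable {ι E : Type*}

theorem LinearIndepOn.exists_insert_of_ncard_lt {K V : Type*} [Field K] [AddCommGroup V]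
    [Module K V] [Finite E] {v : E → V} {I J : Set E} (hI : LinearIndepOn K v I)
    (hJ : LinearIndepOn K v J) (h : I.ncard < J.ncard) :
    ∃ e ∈ J, e ∉ I ∧ LinearIndepOn K v (insert e I) := by
  classical
  have := Fintype.ofFinite E
  by_contra! hcon
  have hsub : Submodule.span K (v '' J) ≤ Submodule.span K (v '' I) := by
    rw [Submodule.span_le]
    rintro _ ⟨e, he, rfl⟩
    by_cases heI : e ∈ I
    · exact Submodule.subset_span ⟨e, heI, rfl⟩
    · by_contra hmem
      exact hcon e he heI (hI.insert hmem)
  have hcard : ∀ L : Set E, LinearIndepOn K v L →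
      Module.finrank K (Submodule.span K (v '' L)) = L.ncard := by
    intro L hL
    have := finrank_span_eq_card (R := K) hL
    rwa [← Set.image_eq_range, ← Nat.card_eq_fintype_card] at this
  have : FiniteDimensional K (Submodule.span K (v '' I)) :=
    FiniteDimensional.span_of_finite K (Set.toFinite _)
  have := Submodule.finrank_mono hsub
  rw [hcard I hI, hcard J hJ] at this
  omega

/-- The linear matroid of a finite list of vectors. -/
def linearMatroid (K : Type*) {V : Type*} [Field K] [AddCommGroup V] [Module K V] [Finite E]
    (v : E → V) : Matroid E :=
  (IndepMatroid.ofFinite (Set.finite_univ (α := E)) (LinearIndepOn K v)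
    (linearIndepOn_empty K v) (fun _ _ hJ hIJ => hJ.mono hIJ)
    (fun _ _ hI hJ h => hI.exists_insert_of_ncard_lt hJ h) (fun _ _ => Set.subset_univ _)).matroid

theorem linearMatroid_indep_iff {K V : Type*} [Field K] [AddCommGroup V] [Module K V] [Finite E]
    {v : E → V} {I : Set E} : (linearMatroid K v).Indep I ↔ LinearIndepOn K v I := Iff.rfl

theorem linearIndepOn_rat_col_iff (A : Matrix ι E ℤ) (I : Set E) :
    LinearIndepOn ℚ (fun e => (A.map (Int.cast : ℤ → ℚ)).col e) I ↔
      LinearIndepOn ℤ (fun e => A.col e) I := by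
  rw [LinearIndepOn, ← LinearIndependent.iff_fractionRing ℤ ℚ]
  let f : (ι → ℤ) →ₗ[ℤ] (ι → ℚ) := (Int.castAddHom ℚ).toIntLinearMap.compLeft ι
  have hf : LinearMap.ker f = ⊥ := by
    rw [LinearMap.ker_eq_bot]
    intro a b hab
    funext i
    exact Int.cast_injective (α := ℚ) (congrFun hab i)
  exact LinearMap.linearIndependent_iff f hf (v := fun e : I => A.col e)

theorem represents_linearMatroid [Finite E] (A : Matrix ι E ℤ) :
    RepresentsMatroid (fun e => A.col e)
      (linearMatroid ℚ fun e => (A.map (Int.cast : ℤ → ℚ)).col e) :=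
  represents_of_indep_iff rfl fun I => by
    rw [linearMatroid_indep_iff, linearIndepOn_rat_col_iff, linearIndepOn_int_iff]

end MatrixMatroid

/-! ### Unimodular families -/

section Unimodular

variable {E G : Type*} [AddCommGroup G]

theorem zsmul_mem_closure_image (p : E → G) (δ : E → ℤ) (A : Set E) :
    AddSubgroup.closure ((fun e => δ e • p e) '' A) ≤ AddSubgroup.closure (p '' A) := by
  rw [AddSubgroup.closure_le]
  rintro _ ⟨e, he, rfl⟩
  exact AddSubgroup.zsmul_mem _ (AddSubgroup.subset_closure (Set.mem_image_of_mem p he)) _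

theorem saturation_closure_zsmul (p : E → G) {δ : E → ℤ} (hδ : ∀ e, δ e ≠ 0) (A : Set E) :
    saturation (AddSubgroup.closure ((fun e => δ e • p e) '' A)) =
      saturation (AddSubgroup.closure (p '' A)) := by
  refine le_antisymm (saturation_mono (zsmul_mem_closure_image p δ A))
    (saturation_le_saturation_iff.mpr ?_)
  rw [AddSubgroup.closure_le]
  rintro _ ⟨e, he, rfl⟩
  exact mem_saturation_of_zsmul_mem (hδ e)
    (AddSubgroup.subset_closure (Set.mem_image_of_mem (fun e => δ e • p e) he))

theorem relIndex_zmultiples_zsmul {g : G} (hg : ∀ k : ℤ, k • g = 0 → k = 0) (c : ℤ) :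
    (AddSubgroup.zmultiples (c • g)).relIndex (AddSubgroup.zmultiples g) = c.natAbs := by
  let f : ℤ →+ G := zmultiplesHom G g
  have hf : Function.Injective f := (injective_iff_map_eq_zero f).mpr fun k hk => hg k (by simpa [f] using hk)
  have h1 : AddSubgroup.zmultiples (c • g) = (AddSubgroup.zmultiples c).map f := by
    rw [AddMonoidHom.map_zmultiples]; simp [f]
  have h2 : AddSubgroup.zmultiples g = (⊤ : AddSubgroup ℤ).map f := by
    ext x; simp [f, AddSubgroup.mem_zmultiples_iff]
  rw [h1, h2, AddSubgroup.relIndex_map_map_of_injective _ _ hf, AddSubgroup.relIndex_top_right,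
    Int.index_zmultiples]

/-- With `P = ⟨p_A⟩` and `Q = ⟨δp_A⟩`, insert `P + ℤδ_e p_e` between the two groups. No nonzero
multiple of `p e` lies in `P`, so by the second isomorphism theorem the lower index is `[P : Q]` and
the upper one is `|δ_e|`. -/
theorem relIndex_closure_insert (p : E → G) (δ : E → ℤ) {A : Set E} {e : E}
    (he : p e ∉ saturation (AddSubgroup.closure (p '' A))) :
    (AddSubgroup.closure ((fun e => δ e • p e) '' insert e A)).relIndex
        (AddSubgroup.closure (p '' insert e A)) =
      (AddSubgroup.closure ((fun e => δ e • p e) '' A)).relIndex (AddSubgroup.closure (p '' A)) *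
        (δ e).natAbs := by
  have hle := zsmul_mem_closure_image p δ A
  rw [closure_image_insert, closure_image_insert]
  set P := AddSubgroup.closure (p '' A)
  set Q := AddSubgroup.closure ((fun e => δ e • p e) '' A)
  have hz : ∀ k : ℤ, k • p e ∈ P → k = 0 := by
    intro k hk
    by_contra hk0
    exact he (mem_saturation_of_zsmul_mem hk0 hk)
  have hZ : AddSubgroup.zmultiples (δ e • p e) ≤ AddSubgroup.zmultiples (p e) := by
    rw [AddSubgroup.zmultiples_le]
    exact AddSubgroup.zsmul_mem_zmultiples _ _
  rw [← AddSubgroup.relIndex_mul_relIndex (Q ⊔ AddSubgroup.zmultiples (δ e • p e))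
    (P ⊔ AddSubgroup.zmultiples (δ e • p e)) (P ⊔ AddSubgroup.zmultiples (p e))
    (sup_le_sup_right hle _) (sup_le_sup_left hZ _)]
  congr 1
  · have h1 : P ⊔ AddSubgroup.zmultiples (δ e • p e) =
        P ⊔ (Q ⊔ AddSubgroup.zmultiples (δ e • p e)) := by
      rw [← sup_assoc, sup_eq_left.mpr hle]
    rw [h1, AddSubgroup.relIndex_sup_right, ← AddSubgroup.inf_relIndex_right]
    congr 1
    refine le_antisymm ?_ (le_inf le_sup_left hle)
    rintro g ⟨hg, hgP⟩
    obtain ⟨a, ha, b, hb, rfl⟩ := AddSubgroup.mem_sup.mp hg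
    obtain ⟨k, rfl⟩ := AddSubgroup.mem_zmultiples_iff.mp hb
    have h2 : (k * δ e) • p e ∈ P := by
      rw [mul_smul]
      simpa using P.sub_mem hgP (hle ha)
    rw [← mul_smul, hz _ h2]
    simp [ha]
  · have h1 : P ⊔ AddSubgroup.zmultiples (p e) =
        AddSubgroup.zmultiples (p e) ⊔ (P ⊔ AddSubgroup.zmultiples (δ e • p e)) := by
      rw [sup_comm P (AddSubgroup.zmultiples (δ e • p e)), ← sup_assoc, sup_eq_left.mpr hZ, sup_comm]
    rw [h1, AddSubgroup.relIndex_sup_right, ← AddSubgroup.inf_relIndex_right]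
    rw [← relIndex_zmultiples_zsmul (g := p e) (fun k hk => hz k (hk ▸ P.zero_mem)) (δ e)]
    congr 1
    refine le_antisymm ?_ (le_inf le_sup_right hZ)
    rintro g ⟨hg, hgp⟩
    obtain ⟨a, ha, b, hb, rfl⟩ := AddSubgroup.mem_sup.mp hg
    obtain ⟨k, rfl⟩ := AddSubgroup.mem_zmultiples_iff.mp hb
    obtain ⟨l, hl⟩ := AddSubgroup.mem_zmultiples_iff.mp hgp
    have h2 : (l - k * δ e) • p e = a := by
      rw [sub_smul, mul_smul, hl]
      abel
    have h3 := hz _ (h2 ▸ ha)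
    rw [h3, zero_smul] at h2
    simp [← h2]

/-- Every subfamily generates a saturated subgroup. -/
def IsUnimodularFamily (p : E → G) : Prop :=
  ∀ A : Set E, saturation (AddSubgroup.closure (p '' A)) = AddSubgroup.closure (p '' A)

theorem IsUnimodularFamily.listMultiplicity_eq {p : E → G} (hp : IsUnimodularFamily p)
    {δ : E → ℤ} (hδ : ∀ e, δ e ≠ 0) (A : Finset E) :
    listMultiplicity (fun e => δ e • p e) A =
      (AddSubgroup.closure ((fun e => δ e • p e) '' (A : Set E))).relIndex
        (AddSubgroup.closure (p '' (A : Set E))) := by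
  rw [listMultiplicity, saturation_closure_zsmul p hδ, hp]

theorem IsUnimodularFamily.listMultiplicity_insert [DecidableEq E] {p : E → G}
    (hp : IsUnimodularFamily p) {δ : E → ℤ} (hδ : ∀ e, δ e ≠ 0) {A : Finset E} {e : E}
    (he : p e ∉ saturation (AddSubgroup.closure (p '' (A : Set E)))) :
    listMultiplicity (fun e => δ e • p e) (insert e A) =
      listMultiplicity (fun e => δ e • p e) A * (δ e).natAbs := by
  rw [hp.listMultiplicity_eq hδ, hp.listMultiplicity_eq hδ, Finset.coe_insert,
    relIndex_closure_insert p δ he]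

end Unimodular

/-! ### Totally unimodular matrices -/

section TotallyUnimodular

open scoped Matrix

variable {ι E : Type*} [Fintype ι]

/-- Row rank equals column rank, so a maximal independent set of rows has exactly as many elements
as `κ`. -/
theorem Matrix.exists_det_submatrix_ne_zero {κ K : Type*} [Field K] [Fintype κ] [DecidableEq κ]
    (N : Matrix ι κ K) (h : LinearIndependent K N.col) :
    ∃ f : κ → ι, (N.submatrix f id).det ≠ 0 := by
  obtain ⟨τ, a, ha, hspan, hli⟩ := exists_linearIndependent' K N.row
  have := Fintype.ofInjective a ha
  have h1 : Fintype.card τ = Fintype.card κ := by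
    rw [← finrank_span_eq_card hli, hspan, ← Matrix.rank_eq_finrank_span_row,
      ← Matrix.rank_transpose]
    exact LinearIndependent.rank_matrix (M := Nᵀ) h
  let eq := Fintype.equivOfCardEq h1
  refine ⟨a ∘ eq.symm, ?_⟩
  rw [← isUnit_iff_ne_zero, ← Matrix.isUnit_iff_isUnit_det,
    ← Matrix.linearIndependent_rows_iff_isUnit]
  exact hli.comp _ eq.symm.injective

theorem Matrix.IsTotallyUnimodular.isUnit_det {ι E : Type*} {A : Matrix ι E ℤ} (hA : A.IsTotallyUnimodular)
    {κ : Type*} [Fintype κ] [DecidableEq κ] (f : κ → ι) (g : κ → E)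
    (h : (A.submatrix f g).det ≠ 0) : IsUnit (A.submatrix f g).det := by
  obtain ⟨s, hs⟩ := (A.isTotallyUnimodular_iff_fintype.mp hA) κ f g
  rw [← hs] at h ⊢
  cases s
  · simp at h
  · simp
  · simp

/-- It suffices to treat a basis `I` of the subfamily. Some square row selection `N` of the columns
`I` is nonsingular, hence invertible over `ℤ`; solving `k • v = A_I c` on those rows shows that `k`
divides `c`. -/
theorem Matrix.IsTotallyUnimodular.isUnimodularFamily [Finite E] {A : Matrix ι E ℤ}
    (hA : A.IsTotallyUnimodular) : IsUnimodularFamily (fun e => A.col e) := by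
  classical
  intro S
  have hrep := represents_linearMatroid A
  obtain ⟨I, hI⟩ := (linearMatroid ℚ fun e => (A.map (Int.cast : ℤ → ℚ)).col e).exists_isBasis S
    (by simp [hrep.ground_eq])
  suffices h : saturation (AddSubgroup.closure ((fun e => A.col e) '' I)) ≤
      AddSubgroup.closure ((fun e => A.col e) '' I) by
    refine le_antisymm ((saturation_le_saturation_iff.mpr ?_).trans
      (h.trans (AddSubgroup.closure_mono (Set.image_mono hI.subset)))) (le_saturation _)
    rw [AddSubgroup.closure_le]
    rintro _ ⟨e, he, rfl⟩
    exact (hrep.mem_closure_iff I e).mp (hI.subset_closure he)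
  have hli : LinearIndepOn ℚ (fun e => (A.map (Int.cast : ℤ → ℚ)).col e) I := hI.indep
  have := Fintype.ofFinite I
  obtain ⟨f, hf⟩ := Matrix.exists_det_submatrix_ne_zero
    ((A.map (Int.cast : ℤ → ℚ)).submatrix id (Subtype.val : I → E)) hli
  have hdet : (A.submatrix f (Subtype.val : I → E)).det ≠ 0 := by
    intro h0
    apply hf
    have : ((A.map (Int.cast : ℤ → ℚ)).submatrix id (Subtype.val : I → E)).submatrix f id =
      (Int.castRingHom ℚ).mapMatrix (A.submatrix f (Subtype.val : I → E)) := rfl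
    rw [this, ← RingHom.map_det, h0, map_zero]
  have hunit := hA.isUnit_det f _ hdet
  set N := A.submatrix f (Subtype.val : I → E) with hN
  have key : ∀ v, v ∈ AddSubgroup.closure ((fun e => A.col e) '' I) ↔
      ∃ c : I → ℤ, A.submatrix id (Subtype.val : I → E) *ᵥ c = v := by
    intro v
    rw [Set.image_eq_range, ← Submodule.span_int_eq_addSubgroupClosure]
    show v ∈ Submodule.span ℤ _ ↔ _
    rw [← Set.mem_range, ← SetLike.mem_coe]
    have := Matrix.range_mulVecLin (A.submatrix id (Subtype.val : I → E))
    have h2 := congrArg (fun W : Submodule ℤ (ι → ℤ) => v ∈ W) this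
    exact (Iff.of_eq h2).symm
  rintro v ⟨k, hk, hv⟩
  obtain ⟨c, hc⟩ := (key _).mp hv
  rw [key]
  have hNc : N *ᵥ c = (k : ℤ) • (v ∘ f) := by
    funext i
    have := congrFun hc (f i)
    simpa [Matrix.mulVec, hN] using this
  have hc' : c = (k : ℤ) • (N⁻¹ *ᵥ (v ∘ f)) := by
    rw [← Matrix.mulVec_smul, ← hNc, Matrix.mulVec_mulVec, Matrix.nonsing_inv_mul _ hunit,
      Matrix.one_mulVec]
  refine ⟨N⁻¹ *ᵥ (v ∘ f), ?_⟩
  rw [hc', Matrix.mulVec_smul, ← natCast_zsmul] at hc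
  exact smul_right_injective _ (by exact_mod_cast hk : (k : ℤ) ≠ 0) hc

end TotallyUnimodular

/-! ### Counting characters -/

section Characters

/-- Characters trivial on `H` are those of `Q ⧸ H`, and a finite abelian group has as many
characters as elements. -/
theorem AddSubgroup.index_eq_card_addChar {Q : Type*} [AddCommGroup Q] [Finite Q]
    (H : AddSubgroup Q) :
    H.index = Nat.card {χ : AddChar Q ℂ // ∀ q ∈ H, χ q = 1} := by
  have := Fintype.ofFinite (Q ⧸ H)
  have h1 : Nat.card (AddChar (Q ⧸ H) ℂ) = H.index := by
    rw [Nat.card_eq_fintype_card, AddChar.card_eq, AddSubgroup.index, Nat.card_eq_fintype_card]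
  rw [← h1]
  refine Nat.card_congr (Equiv.ofBijective (fun ψ =>
    ⟨ψ.compAddMonoidHom (QuotientAddGroup.mk' H), fun q hq => ?_⟩) ⟨?_, ?_⟩)
  · rw [AddChar.compAddMonoidHom_apply, QuotientAddGroup.mk'_apply,
      (QuotientAddGroup.eq_zero_iff q).mpr hq, AddChar.map_zero_eq_one]
  · intro ψ ψ' h
    ext q
    obtain ⟨q, rfl⟩ := QuotientAddGroup.mk_surjective q
    exact DFunLike.congr_fun (congrArg Subtype.val h) q
  · rintro ⟨χ, hχ⟩
    refine ⟨⟨fun q => Quotient.liftOn' q χ ?_, ?_, ?_⟩, ?_⟩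
    · intro a b hab
      rw [QuotientAddGroup.leftRel_apply] at hab
      have := hχ _ hab
      have h2 : χ b = χ a * χ (-a + b) := by rw [← AddChar.map_add_eq_mul]; simp
      rw [h2, this, mul_one]
    · exact χ.map_zero_eq_one
    · rintro ⟨a⟩ ⟨b⟩
      exact χ.map_add_eq_mul a b
    · rfl

/-- By inclusion-exclusion, the sum counts the characters of `Q` that are nontrivial on every `t e`
with `e ∈ T`. -/
theorem sum_powerset_index_closure_nonneg {E Q : Type*} [AddCommGroup Q] [Finite Q]
    (t : E → Q) (T : Finset E) :
    0 ≤ ∑ S ∈ T.powerset, (-1 : ℤ) ^ S.card *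
      ((AddSubgroup.closure (t '' (S : Set E))).index : ℤ) := by
  classical
  have := Fintype.ofFinite Q
  let N : E → Finset (AddChar Q ℂ) := fun e => {χ | χ (t e) = 1}
  have h := Finset.inclusion_exclusion_card_inf_compl T N
  have hS : ∀ S : Finset E, (S.inf N).card = (AddSubgroup.closure (t '' (S : Set E))).index := by
    intro S
    rw [AddSubgroup.index_eq_card_addChar, Nat.card_eq_fintype_card, Fintype.card_subtype]
    congr 1
    ext χ
    rw [Finset.mem_inf, Finset.mem_filter_univ]
    constructor
    · intro hχ q hq
      induction hq using AddSubgroup.closure_induction with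
      | mem q hq =>
        obtain ⟨e, he, rfl⟩ := hq
        simpa [N] using hχ e he
      | zero => exact χ.map_zero_eq_one
      | add a b _ _ ha hb => rw [AddChar.map_add_eq_mul, ha, hb, mul_one]
      | neg a _ ha => rw [AddChar.map_neg_eq_inv, ha, inv_one]
    · intro hχ e he
      simpa [N] using hχ (t e) (AddSubgroup.subset_closure ⟨e, he, rfl⟩)
  simp only [hS] at h
  rw [← h]
  positivity

theorem sum_powerset_relIndex_closure_nonneg {E G : Type*} [AddCommGroup G] (x : E → G)
    (R T : Finset E) (S : AddSubgroup G)
    (hR : AddSubgroup.closure (x '' (R : Set E)) ≤ S) (hT : ∀ e ∈ T, x e ∈ S)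
    (hfin : (AddSubgroup.closure (x '' (R : Set E))).relIndex S ≠ 0) :
    0 ≤ ∑ U ∈ T.powerset, (-1 : ℤ) ^ U.card *
      ((AddSubgroup.closure (x '' ((R : Set E) ∪ U))).relIndex S : ℤ) := by
  classical
  -- The default `0` is never seen: only indices in `R ∪ T` occur, and their vectors lie in `S`.
  let y : E → S := fun e => if h : x e ∈ S then ⟨x e, h⟩ else 0
  have hxS : ∀ e ∈ (R : Set E) ∪ T, x e ∈ S := by
    rintro e (he | he)
    · exact hR (AddSubgroup.subset_closure (Set.mem_image_of_mem x he))
    · exact hT e he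
  have hy : ∀ A ⊆ (R : Set E) ∪ T, (AddSubgroup.closure (x '' A)).relIndex S =
      (AddSubgroup.closure (y '' A)).index := by
    intro A hA
    have h1 : x '' A = S.subtype '' (y '' A) := by
      rw [Set.image_image]
      refine Set.image_congr fun e he => ?_
      simp [y, hxS e (hA he)]
    rw [AddSubgroup.relIndex, h1, ← AddMonoidHom.map_closure, AddSubgroup.addSubgroupOf,
      AddSubgroup.comap_map_eq_self_of_injective S.subtype_injective]
  rw [hy R Set.subset_union_left] at hfin
  set K := AddSubgroup.closure (y '' (R : Set E)) with hK
  have : Finite (S ⧸ K) := AddSubgroup.index_ne_zero_iff_finite.mp hfin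
  refine (sum_powerset_index_closure_nonneg (fun e => (QuotientAddGroup.mk (y e) : S ⧸ K))
    T).trans_eq (Finset.sum_congr rfl fun U hU => ?_)
  rw [hy _ (Set.union_subset_union_right _ (Finset.coe_subset.mpr (Finset.mem_powerset.mp hU))),
    ← AddSubgroup.index_comap_of_surjective _ (QuotientAddGroup.mk'_surjective K),
    comap_mk_closure_image, Set.image_union, AddSubgroup.closure_union, sup_comm]

end Characters

/-! ### The arithmetic matroid of a scaled unimodular family -/

section OfUnimodular

variable {E G : Type*} [DecidableEq E] [AddCommGroup G]

theorem IsMolecule.not_mem_saturation [Finite E] {M : Matroid E} {p : E → G} (hM : RepresentsMatroid p M)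
    {R F T : Finset E} (h : IsMolecule M R F T) {F' T' : Finset E} (hF : F' ⊆ F) (hT : T' ⊆ T)
    {f : E} (hf : f ∈ F) (hf' : f ∉ F') :
    p f ∉ saturation (AddSubgroup.closure (p '' ((R ∪ F' ∪ T' : Finset E) : Set E))) := by
  rw [← hM.eRk_insert_eq_iff, ← Finset.coe_insert]
  have hF2 : ∀ F'' ⊆ F, (R ∪ F'' ∪ T') ∩ F = F'' := by
    intro F'' hF''
    ext x
    have h1 : x ∈ R → x ∉ F := fun hx => Finset.disjoint_left.mp h.disjoint_RF hx
    have h2 : x ∈ F → x ∉ T := fun hx => Finset.disjoint_left.mp h.disjoint_FT hx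
    have h3 : x ∈ F'' → x ∈ F := fun hx => hF'' hx
    have h4 : x ∈ T' → x ∈ T := fun hx => hT hx
    simp only [Finset.mem_inter, Finset.mem_union]
    tauto
  have hr : ∀ F'' ⊆ F, M.eRk ((R ∪ F'' ∪ T' : Finset E) : Set E) =
      M.eRk (R : Set E) + (F''.card : ℕ∞) := by
    intro F'' hF''
    rw [h.rank_eq _ (Finset.subset_union_left.trans Finset.subset_union_left)
      (Finset.union_subset_union (Finset.union_subset_union_right hF'') hT), hF2 _ hF'']
  have h1 : insert f (R ∪ F' ∪ T') = R ∪ insert f F' ∪ T' := by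
    ext x; simp only [Finset.mem_insert, Finset.mem_union]; tauto
  rw [h1, hr _ hF, hr _ (Finset.insert_subset hf hF), Finset.card_insert_of_notMem hf']
  have hfin : M.eRk (R : Set E) ≠ ⊤ :=
    ne_top_of_le_ne_top (Set.encard_ne_top_iff.mpr R.finite_toSet) (M.eRk_le_encard _)
  lift M.eRk (R : Set E) to ℕ using hfin with r
  norm_cast
  omega

theorem IsMolecule.mem_saturation [Finite E] {M : Matroid E} {p : E → G} (hM : RepresentsMatroid p M)
    {R F T : Finset E} (h : IsMolecule M R F T) {e : E} (he : e ∈ T) :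
    p e ∈ saturation (AddSubgroup.closure (p '' (R : Set E))) := by
  rw [← hM.eRk_insert_eq_iff, ← Finset.coe_insert, h.rank_eq _ (Finset.subset_insert _ _)]
  · have : insert e R ∩ F = ∅ := by
      rw [← Finset.disjoint_iff_inter_eq_empty, Finset.disjoint_insert_left]
      exact ⟨Finset.disjoint_right.mp h.disjoint_FT he, h.disjoint_RF⟩
    simp [this]
  · intro x hx
    rcases Finset.mem_insert.mp hx with rfl | hx <;> simp [*]

/-- Each element of the free part raises the rank whatever has been added before, so it contributes
its own factor `|δ_f|`. Axioms (P) and (A2) both rest on this splitting. -/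
theorem IsMolecule.listMultiplicity_eq [Finite E] {M : Matroid E} {p : E → G} (hM : RepresentsMatroid p M)
    (hp : IsUnimodularFamily p) {δ : E → ℤ} (hδ : ∀ e, δ e ≠ 0)
    {R F T : Finset E} (h : IsMolecule M R F T) {F' T' : Finset E} (hF : F' ⊆ F) (hT : T' ⊆ T) :
    listMultiplicity (fun e => δ e • p e) (R ∪ F' ∪ T') =
      listMultiplicity (fun e => δ e • p e) (R ∪ T') * ∏ f ∈ F', (δ f).natAbs := by
  induction F' using Finset.induction_on with
  | empty => simp
  | insert f F' hf ih =>
    have h1 : R ∪ insert f F' ∪ T' = insert f (R ∪ F' ∪ T') := by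
      ext x; simp only [Finset.mem_insert, Finset.mem_union]; tauto
    rw [Finset.insert_subset_iff] at hF
    rw [h1, hp.listMultiplicity_insert hδ (h.not_mem_saturation hM hF.2 hT hF.1 hf), ih hF.2,
      Finset.prod_insert hf, mul_assoc, mul_comm (δ f).natAbs]

theorem IsMolecule.sum_Icc {M : Matroid E} {R F T : Finset E} (h : IsMolecule M R F T)
    (φ : Finset E → ℤ) :
    ∑ A ∈ Finset.Icc R (R ∪ F ∪ T), φ A =
      ∑ F' ∈ F.powerset, ∑ T' ∈ T.powerset, φ (R ∪ F' ∪ T') := by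
  rw [← Finset.sum_product']
  refine Finset.sum_bij' (fun A _ => (A ∩ F, A ∩ T)) (fun P _ => R ∪ P.1 ∪ P.2) ?_ ?_ ?_ ?_ ?_
  · intro A _
    simp
  · rintro ⟨F', T'⟩ hP
    rw [Finset.mem_product, Finset.mem_powerset, Finset.mem_powerset] at hP
    rw [Finset.mem_Icc]
    exact ⟨Finset.subset_union_left.trans Finset.subset_union_left,
      Finset.union_subset_union (Finset.union_subset_union_right hP.1) hP.2⟩
  · intro A hA
    obtain ⟨h1, h2⟩ := Finset.mem_Icc.mp hA
    ext x
    have h1 : x ∈ R → x ∈ A := fun hx => h1 hx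
    have h2 : x ∈ A → x ∈ R ∪ F ∪ T := fun hx => h2 hx
    simp only [Finset.mem_union, Finset.mem_inter] at h2 ⊢
    tauto
  · rintro ⟨F', T'⟩ hP
    rw [Finset.mem_product, Finset.mem_powerset, Finset.mem_powerset] at hP
    have key : ∀ x, (x ∈ (R ∪ F' ∪ T') ∩ F ↔ x ∈ F') ∧ (x ∈ (R ∪ F' ∪ T') ∩ T ↔ x ∈ T') := by
      intro x
      have h1 : x ∈ R → x ∉ F := fun hx => Finset.disjoint_left.mp h.disjoint_RF hx
      have h2 : x ∈ F → x ∉ T := fun hx => Finset.disjoint_left.mp h.disjoint_FT hx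
      have h3 : x ∈ R → x ∉ T := fun hx => Finset.disjoint_left.mp h.disjoint_RT hx
      have h4 : x ∈ F' → x ∈ F := fun hx => hP.1 hx
      have h5 : x ∈ T' → x ∈ T := fun hx => hP.2 hx
      simp only [Finset.mem_inter, Finset.mem_union]
      tauto
    exact Prod.ext (Finset.ext fun x => (key x).1) (Finset.ext fun x => (key x).2)
  · intro A hA
    obtain ⟨h1, h2⟩ := Finset.mem_Icc.mp hA
    congr 1
    ext x
    have h1 : x ∈ R → x ∈ A := fun hx => h1 hx
    have h2 : x ∈ A → x ∈ R ∪ F ∪ T := fun hx => h2 hx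
    simp only [Finset.mem_union, Finset.mem_inter] at h2 ⊢
    tauto

theorem IsMolecule.card_union {M : Matroid E} {R F T F' T' : Finset E} (h : IsMolecule M R F T)
    (hF : F' ⊆ F) (hT : T' ⊆ T) :
    (R ∪ F' ∪ T').card = R.card + F'.card + T'.card := by
  rw [Finset.card_union_of_disjoint (Finset.disjoint_union_left.mpr
      ⟨h.disjoint_RT.mono_right hT, h.disjoint_FT.mono hF hT⟩),
    Finset.card_union_of_disjoint (h.disjoint_RF.mono_right hF)]

/-- The sum factors as `∏ (|δ_f| - 1)` over `F`, nonnegative since `δ` has no zeros, times an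
alternating sum over subsets of `T`, which is a count of characters. -/
theorem IsMolecule.axiom_P_of_unimodular [Finite E] [AddGroup.FG G] {M : Matroid E} {p : E → G}
    (hM : RepresentsMatroid p M) (hp : IsUnimodularFamily p) {δ : E → ℤ} (hδ : ∀ e, δ e ≠ 0)
    {R F T : Finset E} (h : IsMolecule M R F T) :
    0 ≤ (-1 : ℤ) ^ T.card *
      ∑ A ∈ Finset.Icc R (R ∪ F ∪ T), (-1 : ℤ) ^ ((R ∪ F ∪ T).card - A.card) *
        (listMultiplicity (fun e => δ e • p e) A : ℤ) := by
  have hprod : (∑ F' ∈ F.powerset, (-1 : ℤ) ^ (F.card - F'.card) *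
      (∏ f ∈ F', (δ f).natAbs : ℕ)) = ∏ f ∈ F, (((δ f).natAbs : ℤ) - 1) := by
    simp only [sub_eq_add_neg]
    rw [Finset.prod_add]
    refine Finset.sum_congr rfl fun F' hF' => ?_
    rw [Finset.prod_const, Finset.card_sdiff_of_subset (Finset.mem_powerset.mp hF'), mul_comm,
      Nat.cast_prod]
  have hsum : (-1 : ℤ) ^ T.card *
      ∑ A ∈ Finset.Icc R (R ∪ F ∪ T), (-1 : ℤ) ^ ((R ∪ F ∪ T).card - A.card) *
        (listMultiplicity (fun e => δ e • p e) A : ℤ) =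
      (∏ f ∈ F, (((δ f).natAbs : ℤ) - 1)) *
        ∑ T' ∈ T.powerset, (-1 : ℤ) ^ T'.card *
          (listMultiplicity (fun e => δ e • p e) (R ∪ T') : ℤ) := by
    rw [h.sum_Icc, ← hprod, Finset.sum_mul_sum, Finset.mul_sum]
    refine Finset.sum_congr rfl fun F' hF' => ?_
    rw [Finset.mul_sum]
    refine Finset.sum_congr rfl fun T' hT' => ?_
    rw [Finset.mem_powerset] at hF' hT'
    rw [h.listMultiplicity_eq hM hp hδ hF' hT', h.card_union subset_rfl subset_rfl, h.card_union hF' hT']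
    have h1 := Finset.card_le_card hF'
    have h2 := Finset.card_le_card hT'
    have h3 : R.card + F.card + T.card - (R.card + F'.card + T'.card) =
      (F.card - F'.card) + (T.card - T'.card) := by omega
    have h4 : (-1 : ℤ) ^ T.card * (-1 : ℤ) ^ (T.card - T'.card) = (-1 : ℤ) ^ T'.card := by
      rw [← pow_add]
      obtain ⟨k, hk⟩ := Nat.exists_eq_add_of_le h2
      have : T.card + (T.card - T'.card) = T'.card + 2 * k := by omega
      rw [this, pow_add, pow_mul]
      simp
    rw [h3, pow_add, ← h4]
    push_cast
    ring
  rw [hsum]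
  refine mul_nonneg (Finset.prod_nonneg fun f _ => ?_) ?_
  · have := Int.natAbs_pos.mpr (hδ f)
    omega
  -- Elements of `T` do not raise the rank of `R`, so by unimodularity all the indices are taken in
  -- the same group `⟨p_R⟩`.
  · have hS : ∀ T' ⊆ T, AddSubgroup.closure (p '' ((R : Set E) ∪ T')) =
        AddSubgroup.closure (p '' (R : Set E)) := by
      intro T' hT'
      refine le_antisymm ?_ (AddSubgroup.closure_mono (Set.image_mono Set.subset_union_left))
      rw [← hp R, AddSubgroup.closure_le]
      rintro _ ⟨e, he | he, rfl⟩
      · exact le_saturation _ (AddSubgroup.subset_closure (Set.mem_image_of_mem p he))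
      · exact h.mem_saturation hM (hT' he)
    have hle := zsmul_mem_closure_image p δ (R : Set E)
    refine (sum_powerset_relIndex_closure_nonneg (fun e => δ e • p e) R T
      (AddSubgroup.closure (p '' (R : Set E))) hle ?_ ?_).trans_eq
      (Finset.sum_congr rfl fun T' hT' => ?_)
    · intro e he
      have := h.mem_saturation hM he
      rw [hp] at this
      exact AddSubgroup.zsmul_mem _ this _
    · have := relIndex_saturation_ne_zero (AddSubgroup.closure ((fun e => δ e • p e) '' (R : Set E)))
      rwa [saturation_closure_zsmul p hδ, hp] at this
    · rw [hp.listMultiplicity_eq hδ, Finset.coe_union, hS _ (Finset.mem_powerset.mp hT')]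

/-- The arithmetic matroid represented by a scaled unimodular family. -/
noncomputable def ArithmeticMatroid.ofUnimodular [Fintype E] [AddGroup.FG G] (M : Matroid E) (p : E → G)
    (hM : RepresentsMatroid p M) (hp : IsUnimodularFamily p) (δ : E → ℤ) (hδ : ∀ e, δ e ≠ 0) :
    ArithmeticMatroid E where
  matroid := M
  ground_eq := hM.ground_eq
  m := listMultiplicity fun e => δ e • p e
  m_pos A := Nat.one_le_iff_ne_zero.mpr (relIndex_saturation_ne_zero _)
  axiom_P _ _ _ h := h.axiom_P_of_unimodular hM hp hδ
  axiom_A1_dep A e h := by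
    rw [Finset.coe_insert, hM.eRk_insert_eq_iff] at h
    unfold listMultiplicity
    have h1 : saturation (AddSubgroup.closure ((fun e => δ e • p e) '' (insert e A : Finset E))) =
        saturation (AddSubgroup.closure ((fun e => δ e • p e) '' (A : Set E))) := by
      rw [saturation_closure_zsmul p hδ, saturation_closure_zsmul p hδ, Finset.coe_insert]
      refine le_antisymm (saturation_le_saturation_iff.mpr ?_)
        (saturation_mono (AddSubgroup.closure_mono (Set.image_mono (Set.subset_insert _ _))))
      rw [closure_image_insert, sup_le_iff, AddSubgroup.zmultiples_le]
      exact ⟨le_saturation _, h⟩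
    rw [h1]
    refine AddSubgroup.relIndex_dvd_of_le_left _ (AddSubgroup.closure_mono (Set.image_mono ?_))
    simp
  axiom_A1_indep A e h := by
    rw [Finset.coe_insert, ne_eq, hM.eRk_insert_eq_iff] at h
    exact ⟨_, hp.listMultiplicity_insert hδ h⟩
  axiom_A2 R F T h := by
    have h1 := h.listMultiplicity_eq hM hp hδ subset_rfl subset_rfl
    have h2 := h.listMultiplicity_eq hM hp hδ subset_rfl (Finset.empty_subset T)
    simp only [Finset.union_empty] at h2
    rw [h1, h2]
    ring

end OfUnimodular

/-! ### Saturated embeddings and contractions -/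

section Transfer

variable {E G H : Type*} [AddCommGroup G] [AddCommGroup H]

theorem RepresentsMatroid.eq {X : E → G} {M N : Matroid E} (hM : RepresentsMatroid X M)
    (hN : RepresentsMatroid X N) : M = N :=
  Matroid.ext_indep (hM.ground_eq.trans hN.ground_eq.symm) fun I _ => by
    rw [hM.indep_iff, hN.indep_iff]

theorem AddEquiv.saturation_range {G H : Type*} [AddCommGroup G] [AddCommGroup H] (e : G ≃+ H) :
    saturation e.toAddMonoidHom.range = e.toAddMonoidHom.range := by
  rw [AddMonoidHom.range_eq_top.mpr e.surjective]
  exact top_le_iff.mp (le_saturation _)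

theorem saturation_closure_comp {f : G →+ H} (hf : Function.Injective f)
    (hr : saturation f.range = f.range) (X : E → G) (A : Set E) :
    saturation (AddSubgroup.closure ((fun e => f (X e)) '' A)) =
      (saturation (AddSubgroup.closure (X '' A))).map f := by
  rw [← map_saturation_of_injective f hf hr, AddMonoidHom.map_closure, Set.image_image]

theorem representsMatroid_comp_iff {f : G →+ H} (hf : Function.Injective f)
    (hr : saturation f.range = f.range) {X : E → G} {M : Matroid E} :
    RepresentsMatroid (fun e => f (X e)) M ↔ RepresentsMatroid X M := by
  have h : ∀ (A : Set E) (e : E), f (X e) ∈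
      saturation (AddSubgroup.closure ((fun e => f (X e)) '' A)) ↔
      X e ∈ saturation (AddSubgroup.closure (X '' A)) := by
    intro A e
    rw [saturation_closure_comp hf hr]
    exact AddSubgroup.mem_map_iff_mem hf
  constructor
  · exact fun hM => ⟨hM.ground_eq, fun A e => (hM.mem_closure_iff A e).trans (h A e)⟩
  · exact fun hM => ⟨hM.ground_eq, fun A e => (hM.mem_closure_iff A e).trans (h A e).symm⟩

theorem listMultiplicity_comp {f : G →+ H} (hf : Function.Injective f)
    (hr : saturation f.range = f.range) (X : E → G) (A : Finset E) :
    listMultiplicity (fun e => f (X e)) A = listMultiplicity X A := by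
  rw [listMultiplicity, saturation_closure_comp hf hr, ← Set.image_image f X,
    ← AddMonoidHom.map_closure, AddSubgroup.relIndex_map_map_of_injective _ _ hf, listMultiplicity]

/-- Saturated embeddings preserve spans, saturations and indices. This covers isomorphisms, lattice
coordinates and padding by zeros. -/
theorem ArithmeticMatroid.isRepresentedBy_comp_iff [Fintype E] [DecidableEq E]
    {𝒜 : ArithmeticMatroid E} {f : G →+ H} (hf : Function.Injective f)
    (hr : saturation f.range = f.range) {X : E → G} :
    𝒜.IsRepresentedBy (fun e => f (X e)) ↔ 𝒜.IsRepresentedBy X := by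
  simp only [isRepresentedBy_iff, representsMatroid_comp_iff hf hr, listMultiplicity_comp hf hr]

variable {F : Type*}

/-- The dictionary between quotients and contractions: spans modulo `⟨Y⟩` pull back to spans of `A ∪
Y`. -/
theorem comap_mk_closure_inl (X : E ⊕ F → G) (A : Set E) :
    (AddSubgroup.closure ((fun e => (QuotientAddGroup.mk (X (Sum.inl e)) :
      G ⧸ AddSubgroup.closure (Set.range fun i => X (Sum.inr i)))) '' A)).comap
      (QuotientAddGroup.mk' _) =
    AddSubgroup.closure (X '' (Sum.inl '' A ∪ Set.range Sum.inr)) := by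
  rw [comap_mk_closure_image, Set.image_union, AddSubgroup.closure_union, Set.image_image,
    ← Set.range_comp]
  rfl

theorem RepresentsMatroid.contract {X : E ⊕ F → G} {M : Matroid (E ⊕ F)}
    (hM : RepresentsMatroid X M) :
    RepresentsMatroid (fun e => (QuotientAddGroup.mk (X (Sum.inl e)) :
      G ⧸ AddSubgroup.closure (Set.range fun i => X (Sum.inr i))))
      ((M.contract (Set.range Sum.inr)).comap Sum.inl) := by
  have hE : (M.contract (Set.range Sum.inr)).E = Set.range Sum.inl := by
    rw [Matroid.contract_ground, hM.ground_eq, ← Set.compl_eq_univ_sdiff, Set.compl_range_inr]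
  refine represents_of_indep_iff (by rw [Matroid.comap_ground_eq, hE, Set.preimage_range])
    fun I => ?_
  rw [Matroid.comap_indep_iff, and_iff_left (Sum.inl_injective.injOn),
    Matroid.indep_iff_forall_notMem_closure_sdiff (by rw [hE]; exact Set.image_subset_range _ _),
    Set.forall_mem_image]
  refine forall₂_congr fun e _ => not_congr ?_
  rw [Matroid.contract_closure_eq, Set.mem_sdiff, and_iff_left (by simp), hM.mem_closure_iff,
    ← Set.image_singleton, ← Set.image_sdiff Sum.inl_injective, ← comap_mk_closure_inl,
    ← comap_saturation]
  rfl

theorem listMultiplicity_contract [Fintype F] (X : E ⊕ F → G) (A : Finset E) :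
    listMultiplicity (fun e => (QuotientAddGroup.mk (X (Sum.inl e)) :
      G ⧸ AddSubgroup.closure (Set.range fun i => X (Sum.inr i)))) A =
    listMultiplicity X (A.disjSum Finset.univ) := by
  have h : ((A.disjSum Finset.univ : Finset (E ⊕ F)) : Set (E ⊕ F)) =
      Sum.inl '' (A : Set E) ∪ Set.range Sum.inr := by
    ext (e | i) <;> simp
  rw [listMultiplicity, listMultiplicity, h, ← comap_mk_closure_inl, ← comap_saturation,
    AddSubgroup.relIndex_comap, AddSubgroup.map_comap_eq_self_of_surjective
    (QuotientAddGroup.mk'_surjective _)]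

theorem ArithmeticMatroid.IsRepresentedBy.contract [Fintype E] [DecidableEq E] {n : ℕ}
    {ℬ : ArithmeticMatroid (E ⊕ Fin n)} {𝒜 : ArithmeticMatroid E} {X : E ⊕ Fin n → G}
    (hX : ℬ.IsRepresentedBy X) (h : ℬ.IsLifting 𝒜) :
    𝒜.IsRepresentedBy (fun e => (QuotientAddGroup.mk (X (Sum.inl e)) :
      G ⧸ AddSubgroup.closure (Set.range fun i => X (Sum.inr i)))) := by
  rw [isRepresentedBy_iff] at hX ⊢
  refine ⟨h.1 ▸ hX.1.contract, fun A => ?_⟩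
  rw [h.2, hX.2, listMultiplicity_contract]

theorem ArithmeticMatroid.IsRepresentedBy.isLifting [Fintype E] [DecidableEq E] {n : ℕ}
    {ℬ : ArithmeticMatroid (E ⊕ Fin n)} {𝒜 : ArithmeticMatroid E} {X : E ⊕ Fin n → G}
    (hX : ℬ.IsRepresentedBy X) (h : 𝒜.IsRepresentedBy (fun e =>
      (QuotientAddGroup.mk (X (Sum.inl e)) :
        G ⧸ AddSubgroup.closure (Set.range fun i => X (Sum.inr i))))) :
    ℬ.IsLifting 𝒜 := by
  rw [isRepresentedBy_iff] at hX h
  refine ⟨hX.1.contract.eq h.1, fun A => ?_⟩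
  rw [h.2, hX.2, listMultiplicity_contract]

end Transfer

/-! ### Quotients of scaled unimodular lists are strongly multiplicative -/

section OfQSUL

theorem zsmul_mem_saturation_iff {G : Type*} [AddCommGroup G] {K : AddSubgroup G} {c : ℤ}
    (hc : c ≠ 0) {g : G} : c • g ∈ saturation K ↔ g ∈ saturation K := by
  refine ⟨fun h => ?_, fun h => AddSubgroup.zsmul_mem _ h c⟩
  have := mem_saturation_of_zsmul_mem hc h
  rwa [saturation_saturation] at this

theorem representsMatroid_zsmul_iff {E G : Type*} [AddCommGroup G] {p : E → G} {δ : E → ℤ}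
    (hδ : ∀ e, δ e ≠ 0) {M : Matroid E} :
    RepresentsMatroid (fun e => δ e • p e) M ↔ RepresentsMatroid p M := by
  have h : ∀ (A : Set E) (e : E), δ e • p e ∈
      saturation (AddSubgroup.closure ((fun e => δ e • p e) '' A)) ↔
      p e ∈ saturation (AddSubgroup.closure (p '' A)) := by
    intro A e
    rw [saturation_closure_zsmul p hδ, zsmul_mem_saturation_iff (hδ e)]
  constructor
  · exact fun hM => ⟨hM.ground_eq, fun A e => (hM.mem_closure_iff A e).trans (h A e)⟩
  · exact fun hM => ⟨hM.ground_eq, fun A e => (hM.mem_closure_iff A e).trans (h A e).symm⟩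

/-- The hypothesis says that `B` is independent after contracting `Y`, so each element adjoined to
`Y` raises the rank. -/
theorem IsUnimodularFamily.listMultiplicity_union {E G : Type*} [DecidableEq E] [AddCommGroup G]
    {p : E → G} (hp : IsUnimodularFamily p) {δ : E → ℤ} (hδ : ∀ e, δ e ≠ 0) {B Y : Finset E}
    (h : ∀ e ∈ B, p e ∉ saturation
      (AddSubgroup.closure (p '' (((B : Set E) \ {e}) ∪ (Y : Set E))))) :
    listMultiplicity (fun e => δ e • p e) (B ∪ Y) =
      (∏ e ∈ B, (δ e).natAbs) * listMultiplicity (fun e => δ e • p e) Y := by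
  induction B using Finset.induction_on with
  | empty => simp
  | insert b B hb ih =>
    have h1 := h b (Finset.mem_insert_self b B)
    rw [Finset.coe_insert, Set.insert_sdiff_of_mem _ (Set.mem_singleton b), Set.sdiff_singleton_eq_self
      (by simpa using hb), ← Finset.coe_union] at h1
    rw [Finset.insert_union, hp.listMultiplicity_insert hδ h1, ih, Finset.prod_insert hb]
    · ring
    · intro e he hmem
      refine h e (Finset.mem_insert_of_mem he) (saturation_mono (AddSubgroup.closure_mono
        (Set.image_mono (Set.union_subset_union_left _ (Set.sdiff_subset_sdiff_left ?_)))) hmem)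
      simp

theorem listMultiplicity_empty {E G : Type*} [AddCommGroup G] [IsAddTorsionFree G] (X : E → G) :
    listMultiplicity X ∅ = 1 := by
  simp [listMultiplicity, saturation_bot_of_isAddTorsionFree]

theorem IsUnimodularFamily.prod_listMultiplicity {E G : Type*} [DecidableEq E] [AddCommGroup G]
    {p : E → G} (hp : IsUnimodularFamily p) {δ : E → ℤ} (hδ : ∀ e, δ e ≠ 0) {B Y : Finset E}
    (h : ∀ e ∈ B, p e ∉ saturation
      (AddSubgroup.closure (p '' (((B : Set E) \ {e}) ∪ (Y : Set E)))))
    (hY : listMultiplicity (fun e => δ e • p e) Y = 1) :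
    listMultiplicity (fun e => δ e • p e) (B ∪ Y) =
      ∏ b ∈ B, listMultiplicity (fun e => δ e • p e) ({b} ∪ Y) := by
  rw [hp.listMultiplicity_union hδ h, hY, mul_one]
  refine Finset.prod_congr rfl fun b hb => ?_
  rw [hp.listMultiplicity_union hδ, hY, mul_one, Finset.prod_singleton]
  intro e he hmem
  rw [Finset.mem_singleton] at he
  subst he
  refine h e hb (saturation_mono (AddSubgroup.closure_mono
    (Set.image_mono (Set.union_subset_union_left _ ?_))) hmem)
  simp

theorem Matrix.IsTotallyUnimodular.intCast {m n : Type*} {A : Matrix m n ℤ}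
    (hA : A.IsTotallyUnimodular) : (A.map (Int.cast : ℤ → ℚ)).IsTotallyUnimodular := by
  intro k f g hf hg
  obtain ⟨s, hs⟩ := hA k f g hf hg
  have : (A.map (Int.cast : ℤ → ℚ)).submatrix f g =
    (Int.castRingHom ℚ).mapMatrix (A.submatrix f g) := rfl
  refine ⟨s, ?_⟩
  rw [this, ← RingHom.map_det, ← hs]
  cases s <;> simp

variable {E : Type*} [Fintype E] [DecidableEq E]

theorem col_mul_diagonal {d : ℕ} (A : Matrix (Fin d) E ℤ) (δ : E → ℤ) :
    (A * Matrix.diagonal δ).col = fun e => δ e • A.col e := by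
  funext e i
  simp [Matrix.col, mul_comm]

theorem ArithmeticMatroid.IsRepresentedByQSUL.isStronglyMultiplicative {𝒜 : ArithmeticMatroid E}
    (h : 𝒜.IsRepresentedByQSUL) : 𝒜.IsStronglyMultiplicative := by
  obtain ⟨G, _, _, X, ⟨d, n, L, φ, ⟨A, δ, hA, hδ, hL⟩, hX⟩, hrep⟩ := h
  have hp := hA.isUnimodularFamily
  have hM := represents_linearMatroid A
  have hLcol : L.col = fun e => δ e • A.col e := by rw [hL, col_mul_diagonal]
  have : AddGroup.FG (Fin (d + n) → ℤ) := Module.Finite.iff_addGroup_fg.mp inferInstance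
  let ℬ := ofUnimodular _ _ hM hp δ hδ
  have hℬ : ℬ.IsRepresentedBy (fun e => δ e • A.col e) :=
    isRepresentedBy_iff.mpr ⟨(representsMatroid_zsmul_iff hδ).mpr hM, fun _ => rfl⟩
  have hℬL : ℬ.IsRepresentedBy L.col := hLcol ▸ hℬ
  have hX' : X = fun e => φ.toAddMonoidHom (QuotientAddGroup.mk (L.col (Sum.inl e))) := funext hX
  rw [hX', isRepresentedBy_comp_iff φ.injective φ.saturation_range] at hrep
  have hlift : ℬ.IsLifting 𝒜 := hℬL.isLifting hrep
  have hempty : ℬ.m ∅ = 1 := listMultiplicity_empty _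
  by_cases htf : 𝒜.IsTorsionFree
  · refine Or.inl ⟨htf, fun B hB => ?_⟩
    have hdisj : ∀ C : Finset E, C.disjSum (Finset.univ : Finset (Fin n)) =
        C.map Function.Embedding.inl ∪ (∅ : Finset E).disjSum Finset.univ := by
      intro C
      ext (e | i) <;> simp
    -- Torsion-freeness of the quotient now reads `m(Y) = 1` in the lifting, as the product formula
    -- relative to `Y` requires.
    rw [IsTorsionFree, hlift.2] at htf
    rw [hlift.2, hdisj]
    refine (hp.prod_listMultiplicity hδ ?_ htf).trans ?_
    · intro e he hmem
      obtain ⟨b, hb, rfl⟩ := Finset.mem_map.mp he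
      refine ((isRepresentedBy_iff.mp hrep).1.indep_iff _).mp hB.indep b hb ?_
      suffices h2 : L.col (Sum.inl b) ∈ saturation (AddSubgroup.closure (L.col ''
          (Sum.inl '' ((B : Set E) \ {b}) ∪ Set.range Sum.inr))) by
        rw [← comap_mk_closure_inl, ← comap_saturation] at h2
        exact h2
      rw [hLcol, saturation_closure_zsmul _ hδ, zsmul_mem_saturation_iff (hδ _)]
      have hset : Sum.inl '' ((B : Set E) \ {b}) ∪ Set.range Sum.inr =
          ((B.map Function.Embedding.inl : Finset (E ⊕ Fin n)) : Set (E ⊕ Fin n)) \ {Sum.inl b} ∪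
            ((∅ : Finset E).disjSum (Finset.univ : Finset (Fin n))) := by
        ext (e | i) <;> simp
      rw [hset]
      exact hmem
    · rw [Finset.prod_map]
      refine Finset.prod_congr rfl fun b _ => ?_
      rw [hlift.2, hdisj {b}, Finset.map_singleton]
      rfl
  · refine Or.inr ⟨htf, n, ℬ, hlift, ⟨hempty, ⟨_, _, inferInstance, L.col, hℬL⟩, d + n, _,
      hA.intCast, fun I => Iff.rfl⟩, fun B hB => ?_⟩
    have h := hp.prod_listMultiplicity hδ (B := B) (Y := ∅) ?_ hempty
    · rw [Finset.union_empty] at h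
      simp only [Finset.union_empty] at h
      exact h
    · intro e he hmem
      refine (hM.indep_iff _).mp hB.indep e he ?_
      simpa using hmem

end OfQSUL

/-! ### Lists all of whose bases are multiplicative -/

section Core

open scoped Matrix

theorem exists_primitive {ι : Type*} [Fintype ι] (x : ι → ℤ) :
    ∃ (p : ι → ℤ) (c : ℤ), c ≠ 0 ∧ x = c • p ∧
      saturation (AddSubgroup.zmultiples p) = AddSubgroup.zmultiples p := by
  -- The zero vector gets the scalar `1`, so that loops also have a nonzero `δ`.
  by_cases hx : x = 0
  · refine ⟨0, 1, one_ne_zero, by simp [hx], ?_⟩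
    rw [AddSubgroup.zmultiples_zero_eq_bot, saturation_bot_of_isAddTorsionFree]
  obtain ⟨j, hj⟩ := Function.ne_iff.mp hx
  obtain ⟨p, hp, hp1⟩ := Finset.extract_gcd (s := Finset.univ) x ⟨j, Finset.mem_univ j⟩
  refine ⟨p, Finset.univ.gcd x, ?_, funext fun i => hp i (Finset.mem_univ i),
    le_antisymm ?_ (le_saturation _)⟩
  · intro h0
    exact hj (Finset.gcd_eq_zero_iff.mp h0 j (Finset.mem_univ j))
  · rintro v ⟨k, hk, hv⟩
    obtain ⟨c, hc⟩ := AddSubgroup.mem_zmultiples_iff.mp hv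
    have hdvd : (k : ℤ) ∣ c := by
      have h1 : (k : ℤ) ∣ Finset.univ.gcd fun i => c * p i := by
        refine Finset.dvd_gcd fun i _ => ⟨v i, ?_⟩
        simpa using congrFun hc i
      rw [Finset.gcd_mul_left, hp1, mul_one] at h1
      exact dvd_normalize_iff.mp h1
    obtain ⟨a, rfl⟩ := hdvd
    refine AddSubgroup.mem_zmultiples_iff.mpr ⟨a, ?_⟩
    rw [mul_smul, ← natCast_zsmul] at hc
    exact smul_right_injective _ (by exact_mod_cast hk : (k : ℤ) ≠ 0) hc

variable {E G : Type*} [DecidableEq E] [AddCommGroup G]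

theorem relIndex_closure_of_indep [IsAddTorsionFree G] (p : E → G) (δ : E → ℤ) {B : Finset E}
    (h : ∀ e ∈ B, p e ∉ saturation (AddSubgroup.closure (p '' ((B : Set E) \ {e})))) :
    (AddSubgroup.closure ((fun e => δ e • p e) '' (B : Set E))).relIndex
      (AddSubgroup.closure (p '' (B : Set E))) = ∏ e ∈ B, (δ e).natAbs := by
  induction B using Finset.induction_on with
  | empty => simp
  | insert b B hb ih =>
    have h1 := h b (Finset.mem_insert_self b B)
    rw [Finset.coe_insert, Set.insert_sdiff_of_mem _ (Set.mem_singleton b),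
      Set.sdiff_singleton_eq_self (by simpa using hb)] at h1
    rw [Finset.coe_insert, relIndex_closure_insert p δ h1, ih, Finset.prod_insert hb, mul_comm]
    intro e he hmem
    refine h e (Finset.mem_insert_of_mem he) (saturation_mono (AddSubgroup.closure_mono
      (Set.image_mono (Set.sdiff_subset_sdiff_left ?_))) hmem)
    simp

/-- Primitivity gives `m({e}) = |δ_e|`, while `m(B)` is `∏ |δ_e|` times the index of `⟨p_B⟩` in its
saturation. Cancelling the nonzero product leaves index one. -/
theorem saturation_closure_of_multiplicative [IsAddTorsionFree G] [AddGroup.FG G]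
    {p : E → G} {δ : E → ℤ} (hδ : ∀ e, δ e ≠ 0)
    (hprim : ∀ e, saturation (AddSubgroup.zmultiples (p e)) = AddSubgroup.zmultiples (p e))
    {B : Finset E}
    (h : ∀ e ∈ B, p e ∉ saturation (AddSubgroup.closure (p '' ((B : Set E) \ {e}))))
    (hB : listMultiplicity (fun e => δ e • p e) B =
      ∏ e ∈ B, listMultiplicity (fun e => δ e • p e) {e}) :
    saturation (AddSubgroup.closure (p '' (B : Set E))) =
      AddSubgroup.closure (p '' (B : Set E)) := by
  have h1 : ∀ e ∈ B, listMultiplicity (fun e => δ e • p e) {e} = (δ e).natAbs := by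
    intro e he
    have hc : AddSubgroup.closure (p '' ({e} : Finset E)) = AddSubgroup.zmultiples (p e) := by
      rw [Finset.coe_singleton, Set.image_singleton, AddSubgroup.zmultiples_eq_closure]
    have h2 := relIndex_closure_of_indep p δ (B := {e}) (by
      intro f hf hmem
      rw [Finset.mem_singleton] at hf
      subst hf
      refine h f he (saturation_mono (AddSubgroup.closure_mono (Set.image_mono ?_)) hmem)
      simp)
    rw [Finset.prod_singleton, hc] at h2
    rw [listMultiplicity, saturation_closure_zsmul p hδ, hc, hprim, h2]
  rw [Finset.prod_congr rfl h1, listMultiplicity, saturation_closure_zsmul p hδ,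
    ← AddSubgroup.relIndex_mul_relIndex _ _ _ (zsmul_mem_closure_image p δ _) (le_saturation _),
    relIndex_closure_of_indep p δ h] at hB
  have h0 : ∏ e ∈ B, (δ e).natAbs ≠ 0 :=
    Finset.prod_ne_zero_iff.mpr fun e _ => Int.natAbs_ne_zero.mpr (hδ e)
  exact le_antisymm (AddSubgroup.relIndex_eq_one.mp (Nat.eq_of_mul_eq_mul_left
    (Nat.pos_of_ne_zero h0) (hB.trans (mul_one _).symm))) (le_saturation _)

/-- A nonsingular square submatrix, completed by the unit columns of the missing rows, spans the
matroid and hence generates `ℤ^κ`. Restricting to its rows kills those unit columns, so the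
submatrix is surjective over `ℤ` and its determinant is a unit. -/
theorem isTotallyUnimodular_of_bases {κ E : Type*} [Fintype κ] [DecidableEq κ] {M : Matroid E}
    {A : Matrix κ E ℤ} (hM : RepresentsMatroid A.col M)
    {b : κ → E} (hb : ∀ i j, A j (b i) = if i = j then 1 else 0)
    (hbase : ∀ B, M.IsBase B → AddSubgroup.closure (A.col '' B) = ⊤) :
    A.IsTotallyUnimodular := by
  classical
  intro k f g hf hg
  set N := A.submatrix f g with hN
  by_cases hdet : N.det = 0
  · exact ⟨0, by simp [hdet]⟩
  suffices hunit : IsUnit N.det by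
    rcases Int.isUnit_iff.mp hunit with h | h
    · exact ⟨1, by simp [h]⟩
    · exact ⟨-1, by simp [h]⟩
  let J : Set E := Set.range g ∪ b '' (Set.range f)ᶜ
  have hg_mem : ∀ i, A.col (g i) ∈ AddSubgroup.closure (A.col '' J) := fun i =>
    AddSubgroup.subset_closure (Set.mem_image_of_mem _ (Or.inl ⟨i, rfl⟩))
  have hb_mem : ∀ i, i ∉ Set.range f → A.col (b i) ∈ AddSubgroup.closure (A.col '' J) :=
    fun i hi => AddSubgroup.subset_closure
      (Set.mem_image_of_mem _ (Or.inr (Set.mem_image_of_mem b hi)))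
  have hspan : M.Spanning J := by
    refine (Matroid.spanning_iff_ground_subset_closure (by simp [hM.ground_eq])).mpr fun e _ => ?_
    rw [hM.mem_closure_iff]
    refine mem_saturation_of_zsmul_mem hdet ?_
    have h1 : N *ᵥ (N.adjugate *ᵥ (A.col e ∘ f)) = N.det • (A.col e ∘ f) := by
      rw [Matrix.mulVec_mulVec, Matrix.mul_adjugate, Matrix.smul_mulVec, Matrix.one_mulVec]
    set c := N.adjugate *ᵥ (A.col e ∘ f)
    -- Cramer's rule: `w` vanishes on the rows chosen by `f`, so it is a combination of the unit
    -- columns in `J`.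
    set w := N.det • A.col e - ∑ i, c i • A.col (g i) with hw
    have hw0 : ∀ i ∈ Set.range f, w i = 0 := by
      rintro _ ⟨i, rfl⟩
      have := congrFun h1 i
      simp only [Matrix.mulVec, dotProduct, Pi.smul_apply, smul_eq_mul, Function.comp_apply] at this
      simp only [hw, Pi.sub_apply, Pi.smul_apply, smul_eq_mul, Finset.sum_apply]
      rw [← this, sub_eq_zero]
      exact Finset.sum_congr rfl fun j _ => mul_comm _ _
    have hwsum : w = ∑ i, w i • A.col (b i) := by
      funext j
      simp [Finset.sum_apply, Matrix.col_apply, hb]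
    have hwmem : w ∈ AddSubgroup.closure (A.col '' J) := by
      rw [hwsum]
      refine AddSubgroup.sum_mem _ fun i _ => ?_
      by_cases hi : i ∈ Set.range f
      · rw [hw0 i hi, zero_smul]
        exact AddSubgroup.zero_mem _
      · exact AddSubgroup.zsmul_mem _ (hb_mem i hi) _
    have h2 : N.det • A.col e = w + ∑ i, c i • A.col (g i) := by simp [hw]
    rw [h2]
    exact AddSubgroup.add_mem _ hwmem
      (AddSubgroup.sum_mem _ fun i _ => AddSubgroup.zsmul_mem _ (hg_mem i) _)
  obtain ⟨B, hB, hBJ⟩ := hspan.exists_isBase_subset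
  have htop : AddSubgroup.closure (A.col '' J) = ⊤ :=
    top_le_iff.mp ((hbase B hB).symm.le.trans (AddSubgroup.closure_mono (Set.image_mono hBJ)))
  have key : ∀ w ∈ AddSubgroup.closure (A.col '' J), ∃ c, N *ᵥ c = w ∘ f := by
    intro w hw
    induction hw using AddSubgroup.closure_induction with
    | mem w hw =>
      obtain ⟨_, ⟨i, rfl⟩ | ⟨i, hi, rfl⟩, rfl⟩ := hw
      · exact ⟨Pi.single i 1, by rw [Matrix.mulVec_single_one]; rfl⟩
      · refine ⟨0, ?_⟩
        rw [Matrix.mulVec_zero]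
        funext j
        have : i ≠ f j := fun h => hi ⟨j, h.symm⟩
        simp [Matrix.col_apply, hb, this]
    | zero => exact ⟨0, Matrix.mulVec_zero _⟩
    | add u v _ _ hu hv =>
      obtain ⟨c, hc⟩ := hu
      obtain ⟨d, hd⟩ := hv
      exact ⟨c + d, by rw [Matrix.mulVec_add, hc, hd]; rfl⟩
    | neg u _ hu =>
      obtain ⟨c, hc⟩ := hu
      exact ⟨-c, by rw [Matrix.mulVec_neg, hc]; rfl⟩
  rw [← Matrix.isUnit_iff_isUnit_det, ← Matrix.mulVec_surjective_iff_isUnit]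
  intro v
  obtain ⟨c, hc⟩ := key (Function.extend f v 0) (htop ▸ AddSubgroup.mem_top _)
  exact ⟨c, hc.trans (funext fun i => hf.extend_apply v 0 i)⟩

end Core

/-! ### Strongly multiplicative arithmetic matroids are represented by scaled unimodular lists -/

section ToQSUL

/-- The saturation of the trivial subgroup is the torsion subgroup. -/
theorem isAddTorsionFree_of_listMultiplicity_empty {E G : Type*} [AddCommGroup G] {X : E → G}
    (h : listMultiplicity X ∅ = 1) : IsAddTorsionFree G := by
  have h1 : saturation (⊥ : AddSubgroup G) ≤ ⊥ := by
    simpa [listMultiplicity] using h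
  have h2 : ∀ (k : ℕ), k ≠ 0 → ∀ g : G, k • g = 0 → g = 0 := fun k hk g hg =>
    AddSubgroup.mem_bot.mp (h1 ⟨k, hk, AddSubgroup.mem_bot.mpr hg⟩)
  refine ⟨fun k hk a b hab => sub_eq_zero.mp (h2 k hk _ ?_)⟩
  rw [smul_sub]
  exact sub_eq_zero.mpr hab

theorem exists_addEquiv_pi_int (G : Type*) [AddCommGroup G] [AddGroup.FG G] [IsAddTorsionFree G] :
    ∃ r : ℕ, Nonempty (G ≃+ (Fin r → ℤ)) := by
  have : Module.Finite ℤ G := Module.Finite.iff_addGroup_fg.mpr inferInstance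
  exact ⟨_, ⟨(Module.finBasis ℤ G).equivFun.toAddEquiv⟩⟩

variable {E : Type*} [Fintype E]

/-- A list all of whose bases generate a saturated subgroup is, up to a saturated embedding, the
list of columns of a totally unimodular matrix. -/
theorem exists_totallyUnimodular {r : ℕ} {M : Matroid E} {p : E → Fin r → ℤ}
    (hM : RepresentsMatroid p M)
    (hbase : ∀ B, M.IsBase B →
      saturation (AddSubgroup.closure (p '' B)) = AddSubgroup.closure (p '' B)) :
    ∃ (s : ℕ) (A : Matrix (Fin s) E ℤ) (ψ : (Fin s → ℤ) →+ (Fin r → ℤ)),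
      A.IsTotallyUnimodular ∧ Function.Injective ψ ∧ saturation ψ.range = ψ.range ∧
      ∀ e, ψ (A.col e) = p e := by
  classical
  -- All bases generate one lattice, the saturation of the whole list; coordinates in any one of
  -- them are therefore integral for every `p e`.
  have hsat : ∀ B, M.IsBase B →
      AddSubgroup.closure (p '' B) = saturation (AddSubgroup.closure (Set.range p)) := by
    intro B hB
    rw [← hbase B hB]
    refine le_antisymm (saturation_mono (AddSubgroup.closure_mono (Set.image_subset_range _ _)))
      (saturation_le_saturation_iff.mpr ?_)
    rw [AddSubgroup.closure_le]
    rintro _ ⟨e, rfl⟩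
    refine (hM.mem_closure_iff B e).mp ?_
    rw [hB.closure_eq, hM.ground_eq]
    trivial
  obtain ⟨B₀, hB₀⟩ := M.exists_isBase
  let eq : Fin (Fintype.card B₀) ≃ B₀ := (Fintype.equivFin B₀).symm
  let b : Fin (Fintype.card B₀) → E := fun i => eq i
  have hbrange : Set.range (p ∘ b) = p '' B₀ := by
    rw [Set.range_comp]
    congr 1
    ext e
    constructor
    · rintro ⟨i, rfl⟩
      exact (eq i).2
    · exact fun he => ⟨eq.symm ⟨e, he⟩, by simp [b]⟩
  have hli : LinearIndependent ℤ (p ∘ b) := by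
    have h1 : LinearIndepOn ℤ p B₀ :=
      (linearIndepOn_int_iff p B₀).mpr ((hM.indep_iff B₀).mp hB₀.indep)
    exact LinearIndependent.comp h1 eq eq.injective
  let ψ : (Fin (Fintype.card B₀) → ℤ) →+ (Fin r → ℤ) :=
    (Fintype.linearCombination ℤ (p ∘ b)).toAddMonoidHom
  have hψ : Function.Injective ψ := linearIndependent_iff_injective_fintypeLinearCombination.mp hli
  have hrange : ψ.range = AddSubgroup.closure (p '' B₀) := by
    rw [← hbrange, ← Submodule.span_int_eq_addSubgroupClosure, ← Fintype.range_linearCombination]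
    rfl
  have hmem : ∀ e, ∃ c, ψ c = p e := by
    intro e
    have : p e ∈ ψ.range := by
      rw [hrange, hsat B₀ hB₀]
      exact le_saturation _ (AddSubgroup.subset_closure ⟨e, rfl⟩)
    exact this
  choose a ha using hmem
  have hrsat : saturation ψ.range = ψ.range := by rw [hrange, hbase B₀ hB₀]
  refine ⟨_, Matrix.of fun i e => a e i, ψ, ?_, hψ, hrsat, ha⟩
  have hpa : (fun e => ψ (a e)) = p := funext ha
  refine isTotallyUnimodular_of_bases (M := M) (b := b) ?_ ?_ ?_
  · exact (representsMatroid_comp_iff hψ hrsat (X := a)).mp (hpa ▸ hM)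
  · intro i j
    have : a (b i) = Pi.single i 1 := by
      apply hψ
      rw [ha]
      simp [ψ, Fintype.linearCombination_apply_single]
    simp [this, Pi.single_apply, eq_comm]
  · intro B hB
    apply AddSubgroup.map_injective hψ
    rw [AddMonoidHom.map_closure, Set.image_image, ← AddMonoidHom.range_eq_map, hrange, hsat B₀ hB₀,
      ← hsat B hB, ← hpa]
    rfl

variable [DecidableEq E]

/-- The number of rows is made at least `n` by appending `n` zero rows, since `IsQSUL` wants ambient
rank `d + n` when `n` columns are contracted. -/
theorem ArithmeticMatroid.IsRepresentedBy.exists_isScaledUnimodular {𝒜 : ArithmeticMatroid E}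
    {G : Type*} [AddCommGroup G] [AddGroup.FG G] {X : E → G} (hX : 𝒜.IsRepresentedBy X)
    (htf : 𝒜.IsTorsionFree) (hmul : 𝒜.AllBasesMultiplicative) (n : ℕ) :
    ∃ (d : ℕ) (L : Matrix (Fin (d + n)) E ℤ), IsScaledUnimodular L ∧ 𝒜.IsRepresentedBy L.col := by
  have : IsAddTorsionFree G :=
    isAddTorsionFree_of_listMultiplicity_empty (((isRepresentedBy_iff.mp hX).2 ∅).symm.trans htf)
  obtain ⟨r, ⟨e⟩⟩ := exists_addEquiv_pi_int G
  replace hX := (isRepresentedBy_comp_iff (f := e.toAddMonoidHom) e.injective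
    e.saturation_range).mpr hX
  choose p δ hδ hp hprim using fun x => exists_primitive (e.toAddMonoidHom (X x))
  have : AddGroup.FG (Fin r → ℤ) := Module.Finite.iff_addGroup_fg.mp inferInstance
  have hXp : (fun x => e.toAddMonoidHom (X x)) = fun x => δ x • p x := funext hp
  rw [hXp, isRepresentedBy_iff, representsMatroid_zsmul_iff hδ] at hX
  obtain ⟨s, A, ψ, hA, hψ, hrange, hψA⟩ := exists_totallyUnimodular hX.1 fun B hB => by
    have h1 := saturation_closure_of_multiplicative hδ hprim (B := B.toFinite.toFinset)
      (by simpa using (hX.1.indep_iff B).mp hB.indep)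
    simp only [Set.Finite.coe_toFinset, ← hX.2] at h1
    exact h1 (hmul _ (by simpa using hB))
  let eq : Fin s ⊕ Fin n ≃ Fin (s + n) := finSumFinEquiv
  let ι : (Fin s → ℤ) →+ (Fin (s + n) → ℤ) :=
    { toFun := fun c i => Sum.elim c 0 (eq.symm i)
      map_zero' := by
        funext i
        rcases eq.symm i with j | j <;> simp
      map_add' := fun c c' => by
        funext i
        rcases h : eq.symm i with j | j <;> simp [h] }
  have hι : Function.Injective ι := fun c c' h => funext fun i => by
    simpa [ι] using congrFun h (eq (Sum.inl i))
  have hιr : saturation ι.range = ι.range := by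
    refine le_antisymm ?_ (le_saturation _)
    rintro v ⟨k, hk, c, hc⟩
    refine ⟨fun i => v (eq (Sum.inl i)), funext fun i => ?_⟩
    obtain ⟨j | j, rfl⟩ := eq.surjective i
    · simp [ι]
    · have := congrFun hc (eq (Sum.inr j))
      simp only [ι, AddMonoidHom.coe_mk, ZeroHom.coe_mk, Equiv.symm_apply_apply, Sum.elim_inr,
        Pi.zero_apply, Pi.smul_apply, nsmul_eq_mul] at this
      simpa [ι, hk, eq_comm] using this
  let A' : Matrix (Fin (s + n)) E ℤ :=
    (Matrix.fromRows A (Matrix.replicateRow (Fin n) 0)).submatrix eq.symm id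
  have hA' : A'.col = fun x => ι (A.col x) := by
    funext x i
    obtain ⟨j | j, rfl⟩ := eq.surjective i <;> simp [A', ι, Matrix.col_apply]
  refine ⟨s, A' * Matrix.diagonal δ, ⟨A', δ, ?_, hδ, rfl⟩, ?_⟩
  · exact ((Matrix.fromRows_replicateRow0_isTotallyUnimodular_iff A).mpr hA).submatrix _ _
  · have h1 : (A' * Matrix.diagonal δ).col = fun x => ι (δ x • A.col x) := by
      rw [col_mul_diagonal, hA']
      exact funext fun x => (map_zsmul ι (δ x) (A.col x)).symm
    have h2 : (fun x => δ x • p x) = fun x => ψ (δ x • A.col x)  :=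
      funext fun x => by rw [map_zsmul, hψA]
    rw [h1, isRepresentedBy_comp_iff hι hιr, ← isRepresentedBy_comp_iff hψ hrange, ← h2,
      isRepresentedBy_iff, representsMatroid_zsmul_iff hδ]
    exact hX

theorem IsScaledUnimodular.submatrix {F : Type*} [Fintype F] [DecidableEq F] {d : ℕ}
    {L : Matrix (Fin d) E ℤ} (hL : IsScaledUnimodular L) (f : F → E) :
    IsScaledUnimodular (L.submatrix id f) := by
  obtain ⟨A, δ, hA, hδ, rfl⟩ := hL
  refine ⟨A.submatrix id f, δ ∘ f, hA.submatrix _ _, fun e => hδ _, ?_⟩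
  ext i e
  simp

theorem ArithmeticMatroid.isRepresentedByQSUL_of_isLifting {𝒜 : ArithmeticMatroid E} {n : ℕ}
    {ℬ : ArithmeticMatroid (E ⊕ Fin n)} (h : ℬ.IsLifting 𝒜) (hrep : ℬ.IsRepresentable)
    (htf : ℬ.IsTorsionFree) (hmul : ℬ.AllBasesMultiplicative) : 𝒜.IsRepresentedByQSUL := by
  obtain ⟨G, _, _, X, hX⟩ := hrep
  obtain ⟨d, L, hL, hLrep⟩ := hX.exists_isScaledUnimodular htf hmul n
  have : AddGroup.FG (Fin (d + n) → ℤ) := Module.Finite.iff_addGroup_fg.mp inferInstance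
  exact ⟨(Fin (d + n) → ℤ) ⧸ rightSpan L, inferInstance, inferInstance,
    fun e => QuotientAddGroup.mk (L.col (Sum.inl e)),
    ⟨d, n, L, AddEquiv.refl _, hL, fun _ => rfl⟩, hLrep.contract h⟩

theorem ArithmeticMatroid.isRepresentedByQSUL_of_isTorsionFree {𝒜 : ArithmeticMatroid E}
    (hrep : 𝒜.IsRepresentable) (htf : 𝒜.IsTorsionFree) (hmul : 𝒜.AllBasesMultiplicative) :
    𝒜.IsRepresentedByQSUL := by
  obtain ⟨G, _, _, X, hX⟩ := hrep
  obtain ⟨d, L, hL, hLrep⟩ := hX.exists_isScaledUnimodular htf hmul 0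
  have : AddGroup.FG (Fin (d + 0) → ℤ) := Module.Finite.iff_addGroup_fg.mp inferInstance
  let L' : Matrix (Fin (d + 0)) (E ⊕ Fin 0) ℤ := L.submatrix id (Sum.elim id Fin.elim0)
  have hbot : rightSpan L' = ⊥ := by simp [rightSpan]
  let φ : ((Fin (d + 0) → ℤ) ⧸ rightSpan L') ≃+ (Fin (d + 0) → ℤ) :=
    (QuotientAddGroup.quotientAddEquivOfEq hbot).trans QuotientAddGroup.quotientBot
  exact ⟨Fin (d + 0) → ℤ, inferInstance, inferInstance, L.col,
    ⟨d, 0, L', φ, hL.submatrix _, fun _ => rfl⟩, hLrep⟩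

end ToQSUL

theorem mainTheorem7 {E : Type*} [Fintype E] [DecidableEq E] (𝒜 : ArithmeticMatroid E)
    (h𝒜 : 𝒜.IsRegular) :
    𝒜.IsStronglyMultiplicative ↔ 𝒜.IsRepresentedByQSUL := by
  refine ⟨?_, fun h => h.isStronglyMultiplicative⟩
  rintro (⟨htf, hmul⟩ | ⟨-, n, ℬ, hlift, ⟨htf, hrep, -⟩, hmul⟩)
  -- Without torsion, strong multiplicativity provides no representation; it comes from regularity.
  -- With torsion, the lifting carries its own.
  · rcases h𝒜 with ⟨-, hrep, -⟩ | ⟨hntf, -⟩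
    · exact ArithmeticMatroid.isRepresentedByQSUL_of_isTorsionFree hrep htf hmul
    · exact absurd htf hntf
  · exact ArithmeticMatroid.isRepresentedByQSUL_of_isLifting hlift hrep htf hmul
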